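/- Setup. Reviewers $i\in[n]$ arrive one after another (indexed in order of arrival) and $d$ papers are given. On the arrival of reviewer $i$ a policy, which knows the similarity matrix $S\in[0,1]^{n\times d}$ and all earlier orderings and bids, chooses (possibly at random) an ordering $\pi_i$ of the papers, where $\pi_i(j)\in\{1,\dots,d\}$ is the position of paper $j$; the reviewer then bids on each paper $j$ independently with probability $f(\pi_i(j),S_{i,j})$. If $g_j$ is the final number of bids on paper $j$, the gain is $\mathcal G=\sum_{j}\gamma_p(g_j)+\lambda\sum_{i}\sum_{j}\gamma_r(\pi_i(j),S_{i,j})$. Let $\gamma_p(x)=\sqrt{x}$, $\gamma_r(k,x)=(2^{x}-1)/\log_2(k+1)$ and $f(k,x)=\mathbf 1\{k=1\}\,\mathbf 1\{x>s/2\}$. Noisy community model. Let $n=d=mq$, let $B$ be the $mq\times mq$ block diagonal matrix with $m$ diagonal blocks equal to the $q\times q$ all-ones matrix, let $s\in[0.01,1]$, and let $S'=P(sB)\widetilde P$ with permutation matrices $P,\widetilde P$. The similarity matrix is $S_{i,j}=s-\nu_{i,j}$ if $S'_{i,j}=s$ and $S_{i,j}=\nu_{i,j}$ if $S'_{i,j}=0$,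 where the $\nu_{i,j}$ are independent and uniform on $(0,\xi)$, with $0<\xi\le(1+\lambda)^{-1}e^{-e\,mq}$. Policies. With $g_{i-1,j}$ the number of bids on paper $j$ before the arrival of reviewer $i$, SUPER* with zero heuristic shows reviewer $i$ an ordering $\pi_i$ given by a permutation-matrix solution $x_{j,k}=\mathbf 1\{\pi_i(j)=k\}$ of the linear program of maximizing $\sum_{j,k}w_{j,k}x_{j,k}$ over all $x\in[0,1]^{d\times d}$ with unit row and column sums, where $w_{j,k}=\lambda\gamma_r(k,S_{i,j})+f(k,S_{i,j})\big(\gamma_p(g_{i-1,j}+1)-\gamma_p(g_{i-1,j})\big)$; ties between maximizers are broken arbitrarily. SIM shows the papers in decreasing order of similarity, with ties broken in favour of fewer bids so far; BID shows them in increasing order of the number of bids so far, with ties broken in favour of higher similarity; in both, further ties are broken uniformly at random. RAND shows each reviewer an independent, uniformly random ordering. Policies are measurable in the similarity matrix, and $\mathbb E$ is the expectation over the noise, the bids and the randomness of the policy. Theorem. For all $m\ge 2$, $q\ge 2$, $\lambda\ge 0$ and every noisy community model as above: (a) $\mathbb E[\mathcal G^{\mathrm{SUPER}^*}]\ge \mathbb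 E[\mathcal G^{\mathrm{ALG}}]-0.0001$ for every policy ALG, and the same inequality holds for the expectations given any fixed realization of the noise in $(0,\xi)^{mq\times mq}$. Moreover, there is a universal constant $c>0$ such that for all $m\ge 2$, $q\ge 2$, $\lambda\ge 0$ and every noisy community model as above: (b) $\mathbb E[\mathcal G^{\mathrm{SUPER}^*}]-\mathbb E[\mathcal G^{\mathrm{SIM}}]\ge c\,d$; (c) $\mathbb E[\mathcal G^{\mathrm{SUPER}^*}]-\mathbb E[\mathcal G^{\mathrm{BID}}]\ge c\,\lambda d/\log_2^2(d)$; (d) $\mathbb E[\mathcal G^{\mathrm{SUPER}^*}]-\mathbb E[\mathcal G^{\mathrm{RAND}}]\ge c\,d$. -/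

import Mathlib

open MeasureTheory Finset

noncomputable section

namespace PaperBidding

/-! ### Orderings, bids and histories

Reviewers are indexed by `Fin n` in their order of arrival, papers by `Fin d`. An ordering of the
papers is a permutation `π`, where `π j` is the (zero-based) position of paper `j`. -/

/-- One visit of a reviewer: the ordering that was shown and the set of papers that were bid on. -/
abbrev Round (d : ℕ) : Type := Equiv.Perm (Fin d) × Finset (Fin d)

/-- A similarity matrix, with reviewers as rows and papers as columns. -/
abbrev Similarity (n d : ℕ) : Type := Fin n → Fin d → ℝ

/-- The position of paper `j` in the ordering `π`, counted from one. -/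
def position {d : ℕ} (π : Equiv.Perm (Fin d)) (j : Fin d) : ℕ := (π j : ℕ) + 1

/-- The number of bids on paper `j` in a sequence of rounds. -/
def bidCount {k d : ℕ} (h : Fin k → Round d) (j : Fin d) : ℕ :=
  (univ.filter fun r : Fin k => j ∈ (h r).2).card

/-- The rounds that happened before the arrival of reviewer `i`. -/
def past {n d : ℕ} (ω : Fin n → Round d) (i : Fin n) : Fin (i : ℕ) → Round d :=
  fun r => ω (Fin.castLE i.isLt.le r)

/-- The data of a bidding problem: paper-side gain, reviewer-side gain, bidding function (the last
two take a position counted from one and a similarity) and trade-off parameter. -/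
structure Model where
  paperGain : ℝ → ℝ
  reviewerGain : ℕ → ℝ → ℝ
  bidProb : ℕ → ℝ → ℝ
  tradeoff : ℝ

/-- A (randomized) algorithm: given the similarity matrix, the arriving reviewer, and all orderings
and bids of the past, a probability distribution over orderings, measurable in the similarities. -/
structure Policy (n d : ℕ) where
  prob : Similarity n d → (i : Fin n) → (Fin (i : ℕ) → Round d) → Equiv.Perm (Fin d) → ℝ
  prob_nonneg : ∀ S i h π, 0 ≤ prob S i h π
  sum_prob : ∀ S i h, ∑ π, prob S i h π = 1
  measurable_prob : ∀ i h π, Measurable fun S => prob S i h π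

/-- The probability that a reviewer with similarities `x`, shown the ordering `π`, bids on exactly
the papers in `b`: the bids on the papers are independent. -/
def bidLaw {d : ℕ} (M : Model) (x : Fin d → ℝ) (π : Equiv.Perm (Fin d)) (b : Finset (Fin d)) : ℝ :=
  ∏ j, if j ∈ b then M.bidProb (position π j) (x j) else 1 - M.bidProb (position π j) (x j)

/-- The probability of the whole sequence `ω` of rounds under the policy `A`. -/
def trajectoryProb {n d : ℕ} (M : Model) (A : Policy n d) (S : Similarity n d)
    (ω : Fin n → Round d) : ℝ :=
  ∏ i, A.prob S i (past ω i) (ω i).1 * bidLaw M (S i) (ω i).1 (ω i).2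

/-- The overall gain of a sequence of rounds. -/
def totalGain {n d : ℕ} (M : Model) (S : Similarity n d) (ω : Fin n → Round d) : ℝ :=
  ∑ j, M.paperGain (bidCount ω j) +
    M.tradeoff * ∑ i, ∑ j, M.reviewerGain (position (ω i).1 j) (S i j)

/-- The expected gain of a policy on a fixed similarity matrix; the expectation is over the bids and
the randomness of the policy. -/
def expectedGain {n d : ℕ} (M : Model) (A : Policy n d) (S : Similarity n d) : ℝ :=
  ∑ ω : Fin n → Round d, trajectoryProb M A S ω * totalGain M S ω

/-! ### SUPER* -/

/-- A heuristic: an estimate of the number of future bids on each paper. -/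
abbrev Heuristic (n d : ℕ) : Type :=
  Similarity n d → (i : Fin n) → (Fin (i : ℕ) → Round d) → Fin d → ℝ

/-- The weight of showing paper `j` at (zero-based) position `k`, for a reviewer with similarities
`x`, bid counts `g` and heuristic values `η`. -/
def superWeight {d : ℕ} (M : Model) (x : Fin d → ℝ) (g : Fin d → ℕ) (η : Fin d → ℝ)
    (j k : Fin d) : ℝ :=
  M.tradeoff * M.reviewerGain ((k : ℕ) + 1) (x j) +
    M.bidProb ((k : ℕ) + 1) (x j) * (M.paperGain (g j + η j + 1) - M.paperGain (g j + η j))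

/-- `x` is feasible for the assignment linear program. -/
def IsAssignment {d : ℕ} (x : Fin d → Fin d → ℝ) : Prop :=
  (∀ j k, x j k ∈ Set.Icc (0 : ℝ) 1) ∧ (∀ j, ∑ k, x j k = 1) ∧ ∀ k, ∑ j, x j k = 1

/-- `π` is read off from an optimal solution of the assignment linear program with weights `w`. -/
def IsOptimalOrder {d : ℕ} (w : Fin d → Fin d → ℝ) (π : Equiv.Perm (Fin d)) : Prop :=
  ∃ x : Fin d → Fin d → ℝ, IsAssignment x ∧
    (∀ y, IsAssignment y → ∑ j, ∑ k, w j k * y j k ≤ ∑ j, ∑ k, w j k * x j k) ∧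
    ∀ j, x j (π j) = 1

/-- `A` is an instance of SUPER* with the heuristic `η`, with an arbitrary (possibly random)
tie-breaking between the optimal solutions of the linear program. -/
def IsSuperStar {n d : ℕ} (M : Model) (η : Heuristic n d) (A : Policy n d) : Prop :=
  ∀ S : Similarity n d, (∀ i j, S i j ∈ Set.Icc (0 : ℝ) 1) → ∀ i h π, A.prob S i h π ≠ 0 →
    IsOptimalOrder (superWeight M (S i) (bidCount h) (η S i h)) π

/-- The zero heuristic. -/
def zeroHeuristic (n d : ℕ) : Heuristic n d := fun _ _ _ _ => 0

/-! ### The baselines -/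

/-- The orderings that show the papers in increasing order of `key`. -/
def sortedOrders {d : ℕ} {α : Type*} [LinearOrder α] (key : Fin d → α) :
    Finset (Equiv.Perm (Fin d)) :=
  univ.filter fun π => ∀ j j', π j < π j' → key j ≤ key j'

theorem sortedOrders_nonempty {d : ℕ} {α : Type*} [LinearOrder α] (key : Fin d → α) :
    (sortedOrders key).Nonempty := by
  refine ⟨(Tuple.sort key)⁻¹, ?_⟩
  simp only [sortedOrders, mem_filter, mem_univ, true_and]
  intro j j' hlt
  have := Tuple.monotone_sort key hlt.le
  simpa using this

/-- The policy that shows each reviewer the papers in increasing order of a key, where ties are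
broken uniformly at random. -/
def sortPolicy {n d : ℕ} {α : Type*} [LinearOrder α]
    (key : Similarity n d → (i : Fin n) → (Fin (i : ℕ) → Round d) → Fin d → α)
    (hkey : ∀ i h j j', MeasurableSet {S | key S i h j ≤ key S i h j'}) : Policy n d where
  prob S i h π :=
    if π ∈ sortedOrders (key S i h) then ((sortedOrders (key S i h)).card : ℝ)⁻¹ else 0
  prob_nonneg S i h π := by split_ifs <;> positivity
  sum_prob S i h := by
    have hc : ((sortedOrders (key S i h)).card : ℝ) ≠ 0 :=
      Nat.cast_ne_zero.mpr (sortedOrders_nonempty (key S i h)).card_pos.ne'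
    rw [Finset.sum_ite_mem, Finset.univ_inter, Finset.sum_const, nsmul_eq_mul, mul_inv_cancel₀ hc]
  measurable_prob i h π := by
    have hm : ∀ σ : Equiv.Perm (Fin d), MeasurableSet {S | σ ∈ sortedOrders (key S i h)} := by
      intro σ
      have : {S | σ ∈ sortedOrders (key S i h)} =
          ⋂ j, ⋂ j', {S | σ j < σ j' → key S i h j ≤ key S i h j'} := by
        ext S; simp [sortedOrders]
      rw [this]
      refine MeasurableSet.iInter fun j => MeasurableSet.iInter fun j' => ?_
      by_cases hlt : σ j < σ j'
      · simpa [hlt] using hkey i h j j'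
      · simp [hlt]
    have hcard : (fun S => ((sortedOrders (key S i h)).card : ℝ)) =
        fun S => ∑ σ, if σ ∈ sortedOrders (key S i h) then (1 : ℝ) else 0 := by
      funext S; simp
    refine Measurable.ite (hm π) (Measurable.inv ?_) measurable_const
    rw [hcard]
    exact Finset.measurable_sum _ fun σ _ =>
      Measurable.ite (hm σ) measurable_const measurable_const

/-- SIM: decreasing similarity, ties in favour of fewer bids, further ties uniformly at random. -/
def simPolicy (n d : ℕ) : Policy n d :=
  sortPolicy (α := Lex (ℝᵒᵈ × ℕ))
    (fun S i h j => toLex (OrderDual.toDual (S i j), bidCount h j))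
    (by
      intro i h j j'
      have hm : ∀ k : Fin d, Measurable fun S : Similarity n d => S i k := fun k =>
        (measurable_pi_apply k).comp (measurable_pi_apply i)
      simp only [Prod.Lex.toLex_le_toLex, OrderDual.toDual_lt_toDual, OrderDual.toDual_inj]
      exact (measurableSet_lt (hm j') (hm j)).union
        ((measurableSet_eq_fun (hm j) (hm j')).inter (MeasurableSet.const _)))

/-- BID: increasing number of bids, ties in favour of higher similarity, further ties uniformly at
random. -/
def bidPolicy (n d : ℕ) : Policy n d :=
  sortPolicy (α := Lex (ℕ × ℝᵒᵈ))
    (fun S i h j => toLex (bidCount h j, OrderDual.toDual (S i j)))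
    (by
      intro i h j j'
      have hm : ∀ k : Fin d, Measurable fun S : Similarity n d => S i k := fun k =>
        (measurable_pi_apply k).comp (measurable_pi_apply i)
      simp only [Prod.Lex.toLex_le_toLex, OrderDual.toDual_le_toDual]
      exact (MeasurableSet.const _).union
        ((MeasurableSet.const _).inter (measurableSet_le (hm j') (hm j))))

/-- RAND: each reviewer is shown an independent, uniformly random ordering. -/
def randPolicy (n d : ℕ) : Policy n d where
  prob _ _ _ _ := ((Nat.factorial d : ℕ) : ℝ)⁻¹
  prob_nonneg _ _ _ _ := by positivity
  sum_prob _ _ _ := by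
    have : ((Nat.factorial d : ℕ) : ℝ) ≠ 0 := Nat.cast_ne_zero.mpr (Nat.factorial_ne_zero d)
    simp [Fintype.card_perm, this]
  measurable_prob _ _ _ := measurable_const

/-! ### The community models -/

/-- The block diagonal matrix with `m` diagonal blocks, each the `q × q` all-ones matrix. -/
def blockMatrix (m q : ℕ) : Matrix (Fin (m * q)) (Fin (m * q)) ℝ :=
  Matrix.of fun i j => if i.divNat = j.divNat then 1 else 0

/-- `S'` belongs to the noiseless community model with similarity level `s`. -/
def IsNoiselessCommunity (m q : ℕ) (s : ℝ) (S' : Matrix (Fin (m * q)) (Fin (m * q)) ℝ) : Prop :=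
  s ∈ Set.Icc (0.01 : ℝ) 1 ∧
    ∃ σ τ : Equiv.Perm (Fin (m * q)),
      S' = σ.permMatrix ℝ * (s • blockMatrix m q) * τ.permMatrix ℝ

/-- The similarity matrix obtained from the noiseless matrix `S'` and the noise `ν`. -/
def noisySimilarity {n d : ℕ} (s : ℝ) (S' : Matrix (Fin n) (Fin d) ℝ) (ν : Fin n × Fin d → ℝ) :
    Similarity n d :=
  fun i j => if S' i j = s then s - ν (i, j) else ν (i, j)

/-- The law of the noise: independent entries, each uniform on `(0, ξ)`. -/
def noiseLaw (n d : ℕ) (ξ : ℝ) : Measure (Fin n × Fin d → ℝ) :=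
  Measure.pi fun _ => ProbabilityTheory.cond volume (Set.Ioo 0 ξ)

/-- The expected gain in the noisy community model; the expectation is over the noise, the bids and
the randomness of the policy. -/
def noisyExpectedGain {n d : ℕ} (M : Model) (A : Policy n d) (s ξ : ℝ)
    (S' : Matrix (Fin n) (Fin d) ℝ) : ℝ :=
  ∫ ν, expectedGain M A (noisySimilarity s S' ν) ∂(noiseLaw n d ξ)

open Classical in
/-- Square-root paper-side gain, discounted cumulative reviewer-side gain, and bids exactly on the
paper at the top position if its similarity exceeds `s / 2`. -/
def thresholdModel (s lam : ℝ) : Model where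
  paperGain x := Real.sqrt x
  reviewerGain k x := ((2 : ℝ) ^ x - 1) / Real.logb 2 ((k : ℝ) + 1)
  bidProb k x := if k = 1 ∧ s / 2 < x then 1 else 0
  tradeoff := lam

end PaperBidding

end

open PaperBidding

/-!
In each community there are as many reviewers as papers and a reviewer bids on at most one paper,
so the paper-side gain is at most the number of bids, hence at most `n`, and no policy gains more
than `n + lam * ∑ i, bestValue (S i)`, where `bestValue (S i)` is the largest reviewer-side gain of
an ordering (`IsCommunity.totalGain_le`). When reviewer `i` arrives, fewer than `q` members of the
community have arrived, so there is a paper of the own community without a bid, a *fresh* paper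
(`IsCommunity.exists_fresh`). Exchanging it with the paper on top of the best ordering costs at most
`swapCost n ξ`, which is of the order of the noise, whereas the objective of SUPER* gains `1` for a
fresh paper and at most `1 / 2` otherwise. Hence SUPER* shows a fresh paper on top, every paper ends
up with exactly one bid, and the upper bound is attained up to `lam * (n * swapCost n ξ)`
(`IsCommunity.le_totalGain_superStar`), which is at most `0.0001`.

The baselines are compared with the same upper bound, for each fixed noise matrix.

* SIM: a paper gets no bid if each member of its community has less noise on another paper of the
  community. The bound `√g ≤ (g + 1) / 2` for `g ≠ 0` turns each such paper into a loss of `1 / 2`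
  (`IsCommunity.totalGain_simPolicy_le`). The rows of the noise are independent and the minimum of a
  row is uniformly distributed over the community by symmetry, so this happens to a given paper with
  probability at least `(1 - 1 / q) ^ q ≥ 1 / 4` (`one_quarter_le_pi_not_min`).
* BID: it collects `n` bids too, but papers that have a bid are shown behind the fresh papers of all
  other communities. Moving the last paper of the own community into the first `q` positions shows
  a loss of at least `displacementLoss`, of order `1 / log₂(n) ^ 2`, for every reviewer that comes
  neither too late nor first in its community; these are at least `n / 8` reviewers
  (`IsCommunity.totalGain_bidPolicy_le`, `exists_displacement_parameters`). The loss is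
  proportional to `lam`, and so is the exchange cost of SUPER*, which is smaller by a constant
  factor already for `n = 4` (`le_displacementLoss_sub_swapCost`).
* RAND: each reviewer bids with probability `q / n ≤ 1 / 2`, so the paper-side gain is at most
  `n / 2` (`IsCommunity.expectedGain_randPolicy_le`).
-/

noncomputable section

namespace PaperBidding

/-! ### Sequences of rounds -/

section Trajectories

variable {R : Type*} [Fintype R]

/-- The bound for the expectation of a sum of one-round rewards, and the total mass of the
trajectory law, both for an arbitrary one-step kernel `p` that may depend on the past. -/
theorem sum_trajectory {n : ℕ} (p : (i : Fin n) → (Fin (i : ℕ) → R) → R → ℝ)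
    (φ : Fin n → R → ℝ) (c : Fin n → ℝ) (hp : ∀ i h r, 0 ≤ p i h r) (h1 : ∀ i h, ∑ r, p i h r = 1)
    (hφ : ∀ i h, ∑ r, p i h r * φ i r ≤ c i) :
    (∑ ω : Fin n → R, ∏ i, p i (fun r => ω (Fin.castLE i.isLt.le r)) (ω i) = 1) ∧
      ∑ ω : Fin n → R, (∏ i, p i (fun r => ω (Fin.castLE i.isLt.le r)) (ω i)) * ∑ i, φ i (ω i) ≤
        ∑ i, c i := by
  induction n with
  | zero => simp
  | succ n ih =>
    obtain ⟨ih1, ih2⟩ := ih (fun i => p i.castSucc) (fun i => φ i.castSucc) (fun i => c i.castSucc)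
      (fun i => hp i.castSucc) (fun i => h1 i.castSucc) (fun i => hφ i.castSucc)
    have key : ∀ F : (Fin (n + 1) → R) → ℝ,
        ∑ ω, F ω = ∑ ω : Fin n → R, ∑ r, F (Fin.snoc (α := fun _ => R) ω r) := by
      intro F
      rw [← Fintype.sum_prod_type', ← (Equiv.prodComm R (Fin n → R)).sum_comp,
        ← (Fin.snocEquiv fun _ => R).sum_comp]
      rfl
    have hprod : ∀ (ω : Fin n → R) (r : R),
        (∏ i, p i (fun t => (Fin.snoc (α := fun _ => R) ω r : Fin (n + 1) → R)
            (Fin.castLE i.isLt.le t)) ((Fin.snoc (α := fun _ => R) ω r : Fin (n + 1) → R) i)) =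
          (∏ i : Fin n, p i.castSucc (fun t => ω (Fin.castLE i.isLt.le t)) (ω i)) *
            p (Fin.last n) ω r := by
      intro ω r
      rw [Fin.prod_univ_castSucc]
      congr 1
      · refine Finset.prod_congr rfl fun i _ => ?_
        congr 1
        · funext t
          exact Fin.snoc_castSucc (α := fun _ => R) r ω (Fin.castLE i.isLt.le t)
        · simp
      · congr 1
        · funext t
          exact Fin.snoc_castSucc (α := fun _ => R) r ω t
        · simp
    have hQ : ∀ ω : Fin n → R,
        0 ≤ ∏ i : Fin n, p i.castSucc (fun t => ω (Fin.castLE i.isLt.le t)) (ω i) := fun ω =>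
      Finset.prod_nonneg fun i _ => hp _ _ _
    constructor
    · rw [key]
      simp_rw [hprod, ← Finset.mul_sum, h1, mul_one]
      exact ih1
    · rw [key]
      simp_rw [hprod, Fin.sum_univ_castSucc, Fin.snoc_castSucc, Fin.snoc_last]
      calc _ = ∑ ω : Fin n → R,
            (∏ i : Fin n, p i.castSucc (fun t => ω (Fin.castLE i.isLt.le t)) (ω i)) *
              ((∑ i : Fin n, φ i.castSucc (ω i)) * ∑ r, p (Fin.last n) ω r +
                ∑ r, p (Fin.last n) ω r * φ (Fin.last n) r) := by
            refine Finset.sum_congr rfl fun ω _ => ?_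
            rw [Finset.mul_sum, ← Finset.sum_add_distrib, Finset.mul_sum]
            refine Finset.sum_congr rfl fun r _ => ?_
            ring
        _ ≤ ∑ ω : Fin n → R,
            ((∏ i : Fin n, p i.castSucc (fun t => ω (Fin.castLE i.isLt.le t)) (ω i)) *
              (∑ i : Fin n, φ i.castSucc (ω i)) +
            (∏ i : Fin n, p i.castSucc (fun t => ω (Fin.castLE i.isLt.le t)) (ω i)) *
              c (Fin.last n)) := by
            refine Finset.sum_le_sum fun ω _ => ?_
            rw [h1, mul_one, mul_add]
            exact add_le_add_right (mul_le_mul_of_nonneg_left (hφ _ _) (hQ ω)) _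
        _ = (∑ ω : Fin n → R,
            (∏ i : Fin n, p i.castSucc (fun t => ω (Fin.castLE i.isLt.le t)) (ω i)) *
              (∑ i : Fin n, φ i.castSucc (ω i))) + c (Fin.last n) := by
            rw [Finset.sum_add_distrib, ← Finset.sum_mul]
            exact congrArg (_ + ·) ((congrArg (· * c (Fin.last n)) ih1).trans (one_mul _))
        _ ≤ _ := add_le_add_left ih2 _

end Trajectories

theorem bidLaw_nonneg {d : ℕ} {M : Model} (hM : ∀ k x, M.bidProb k x ∈ Set.Icc (0 : ℝ) 1)
    (x : Fin d → ℝ) (π : Equiv.Perm (Fin d)) (b : Finset (Fin d)) : 0 ≤ bidLaw M x π b := by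
  refine Finset.prod_nonneg fun j _ => ?_
  have := hM (position π j) (x j)
  split_ifs
  · exact this.1
  · linarith [this.2]

theorem sum_bidLaw {d : ℕ} (M : Model) (x : Fin d → ℝ) (π : Equiv.Perm (Fin d)) :
    ∑ b, bidLaw M x π b = 1 := by
  have h := Finset.prod_add (fun j => M.bidProb (position π j) (x j))
    (fun j => 1 - M.bidProb (position π j) (x j)) (univ : Finset (Fin d))
  simp only [add_sub_cancel, prod_const_one, powerset_univ] at h
  rw [h]
  refine Finset.sum_congr rfl fun b _ => ?_
  rw [bidLaw, ← Finset.prod_mul_prod_compl b]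
  congr 1
  · exact Finset.prod_congr rfl fun j hj => by simp [hj]
  · rw [Finset.compl_eq_univ_sdiff]
    exact Finset.prod_congr rfl fun j hj => by
      have : j ∉ b := (Finset.mem_sdiff.1 hj).2
      simp [this]

/-- The expectation of a reward of one round, split into ordering and bids. -/
theorem sum_step {n d : ℕ} (M : Model) (A : Policy n d) (S : Similarity n d) (i : Fin n)
    (h : Fin (i : ℕ) → Round d) (φ : Round d → ℝ) :
    ∑ r : Round d, A.prob S i h r.1 * bidLaw M (S i) r.1 r.2 * φ r =
      ∑ π, A.prob S i h π * ∑ b, bidLaw M (S i) π b * φ (π, b) := by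
  rw [Fintype.sum_prod_type]
  refine Finset.sum_congr rfl fun π _ => ?_
  rw [Finset.mul_sum]
  exact Finset.sum_congr rfl fun b _ => mul_assoc _ _ _

theorem trajectoryProb_nonneg {n d : ℕ} {M : Model}
    (hM : ∀ k x, M.bidProb k x ∈ Set.Icc (0 : ℝ) 1) (A : Policy n d) (S : Similarity n d)
    (ω : Fin n → Round d) : 0 ≤ trajectoryProb M A S ω :=
  Finset.prod_nonneg fun _ _ => mul_nonneg (A.prob_nonneg _ _ _ _) (bidLaw_nonneg hM _ _ _)

/-- The expectation of a sum of one-round rewards `φ i` is at most `∑ i, c i` if, whatever the past,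
the conditional expectation of `φ i` is at most `c i`. -/
theorem sum_trajectoryProb_mul_le {n d : ℕ} {M : Model}
    (hM : ∀ k x, M.bidProb k x ∈ Set.Icc (0 : ℝ) 1) (A : Policy n d) (S : Similarity n d)
    (φ : Fin n → Round d → ℝ) (c : Fin n → ℝ)
    (hφ : ∀ i h, ∑ π, A.prob S i h π * ∑ b, bidLaw M (S i) π b * φ i (π, b) ≤ c i) :
    ∑ ω, trajectoryProb M A S ω * ∑ i, φ i (ω i) ≤ ∑ i, c i :=
  (sum_trajectory (fun i h r => A.prob S i h r.1 * bidLaw M (S i) r.1 r.2) φ c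
    (fun _ _ _ => mul_nonneg (A.prob_nonneg _ _ _ _) (bidLaw_nonneg hM _ _ _))
    (fun i h => by simpa [sum_bidLaw, A.sum_prob] using sum_step M A S i h fun _ => 1)
    (fun i h => by rw [sum_step]; exact hφ i h)).2

theorem sum_trajectoryProb {n d : ℕ} {M : Model}
    (hM : ∀ k x, M.bidProb k x ∈ Set.Icc (0 : ℝ) 1) (A : Policy n d) (S : Similarity n d) :
    ∑ ω, trajectoryProb M A S ω = 1 :=
  (sum_trajectory (fun i h r => A.prob S i h r.1 * bidLaw M (S i) r.1 r.2) (fun _ _ => 0) 0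
    (fun _ _ _ => mul_nonneg (A.prob_nonneg _ _ _ _) (bidLaw_nonneg hM _ _ _))
    (fun i h => by simpa [sum_bidLaw, A.sum_prob] using sum_step M A S i h fun _ => 1)
    (fun i h => by simp)).1

theorem expectedGain_le {n d : ℕ} {M : Model}
    (hM : ∀ k x, M.bidProb k x ∈ Set.Icc (0 : ℝ) 1) {A : Policy n d} {S : Similarity n d} {G : ℝ}
    (hG : ∀ ω, trajectoryProb M A S ω ≠ 0 → totalGain M S ω ≤ G) : expectedGain M A S ≤ G := by
  calc expectedGain M A S ≤ ∑ ω, trajectoryProb M A S ω * G := by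
        refine Finset.sum_le_sum fun ω _ => ?_
        by_cases h : trajectoryProb M A S ω = 0
        · simp [h]
        · exact mul_le_mul_of_nonneg_left (hG ω h) (trajectoryProb_nonneg hM _ _ _)
    _ = G := by rw [← Finset.sum_mul, sum_trajectoryProb hM, one_mul]

theorem le_expectedGain {n d : ℕ} {M : Model}
    (hM : ∀ k x, M.bidProb k x ∈ Set.Icc (0 : ℝ) 1) {A : Policy n d} {S : Similarity n d} {G : ℝ}
    (hG : ∀ ω, trajectoryProb M A S ω ≠ 0 → G ≤ totalGain M S ω) : G ≤ expectedGain M A S := by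
  calc G = ∑ ω, trajectoryProb M A S ω * G := by
        rw [← Finset.sum_mul, sum_trajectoryProb hM, one_mul]
    _ ≤ expectedGain M A S := by
        refine Finset.sum_le_sum fun ω _ => ?_
        by_cases h : trajectoryProb M A S ω = 0
        · simp [h]
        · exact mul_le_mul_of_nonneg_left (hG ω h) (trajectoryProb_nonneg hM _ _ _)

/-! ### The threshold model -/

theorem thresholdModel_bidProb_mem (s lam : ℝ) (k : ℕ) (x : ℝ) :
    (thresholdModel s lam).bidProb k x ∈ Set.Icc (0 : ℝ) 1 := by
  simp only [thresholdModel]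
  split_ifs <;> simp

theorem mem_of_bidLaw_ne_zero {d : ℕ} {s lam : ℝ} {x : Fin d → ℝ} {π : Equiv.Perm (Fin d)}
    {b : Finset (Fin d)} (h : bidLaw (thresholdModel s lam) x π b ≠ 0) (j : Fin d) :
    j ∈ b ↔ (π j : ℕ) = 0 ∧ s / 2 < x j := by
  have hj := Finset.prod_ne_zero_iff.1 h j (mem_univ j)
  by_cases hb : j ∈ b <;> by_cases hc : (π j : ℕ) = 0 ∧ s / 2 < x j <;>
    simp_all [thresholdModel, position]

theorem prob_ne_zero_of_trajectoryProb_ne_zero {n d : ℕ} {M : Model} {A : Policy n d}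
    {S : Similarity n d} {ω : Fin n → Round d} (h : trajectoryProb M A S ω ≠ 0) (i : Fin n) :
    A.prob S i (past ω i) (ω i).1 ≠ 0 :=
  left_ne_zero_of_mul (Finset.prod_ne_zero_iff.1 h i (mem_univ i))

theorem bidLaw_ne_zero_of_trajectoryProb_ne_zero {n d : ℕ} {M : Model} {A : Policy n d}
    {S : Similarity n d} {ω : Fin n → Round d} (h : trajectoryProb M A S ω ≠ 0) (i : Fin n) :
    bidLaw M (S i) (ω i).1 (ω i).2 ≠ 0 :=
  right_ne_zero_of_mul (Finset.prod_ne_zero_iff.1 h i (mem_univ i))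

/-! ### The reviewer-side gain of an ordering -/

/-- The reviewer-side gain of showing the ordering `π` to a reviewer with similarities `x`. -/
def reviewerValue {d : ℕ} (x : Fin d → ℝ) (π : Equiv.Perm (Fin d)) : ℝ :=
  ∑ j, ((2 : ℝ) ^ x j - 1) / Real.logb 2 ((position π j : ℝ) + 1)

/-- The largest reviewer-side gain of an ordering. -/
def bestValue {d : ℕ} (x : Fin d → ℝ) : ℝ :=
  (univ : Finset (Equiv.Perm (Fin d))).sup' ⟨1, mem_univ 1⟩ (reviewerValue x)

theorem reviewerValue_le_bestValue {d : ℕ} (x : Fin d → ℝ) (π : Equiv.Perm (Fin d)) :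
    reviewerValue x π ≤ bestValue x :=
  Finset.le_sup' (reviewerValue x) (mem_univ π)

theorem exists_reviewerValue_eq_bestValue {d : ℕ} (x : Fin d → ℝ) :
    ∃ π, reviewerValue x π = bestValue x := by
  obtain ⟨π, -, h⟩ := Finset.exists_mem_eq_sup' (s := (univ : Finset (Equiv.Perm (Fin d))))
    ⟨1, mem_univ 1⟩ (reviewerValue x)
  exact ⟨π, h.symm⟩

theorem totalGain_thresholdModel {n d : ℕ} (s lam : ℝ) (S : Similarity n d)
    (ω : Fin n → Round d) :
    totalGain (thresholdModel s lam) S ω =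
      ∑ j, √(bidCount ω j : ℝ) + lam * ∑ i, reviewerValue (S i) (ω i).1 := rfl

/-- The effect of exchanging the positions of two papers. -/
theorem reviewerValue_mul_swap {d : ℕ} (x : Fin d → ℝ) (π : Equiv.Perm (Fin d)) {a b : Fin d}
    (hab : a ≠ b) :
    reviewerValue x (π * Equiv.swap a b) = reviewerValue x π +
      ((2 : ℝ) ^ x a - 2 ^ x b) *
        (1 / Real.logb 2 ((position π b : ℝ) + 1) - 1 / Real.logb 2 ((position π a : ℝ) + 1)) := by
  have hsum : reviewerValue x (π * Equiv.swap a b) - reviewerValue x π =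
      ∑ j, ((2 : ℝ) ^ x j - 1) * (1 / Real.logb 2 ((position π (Equiv.swap a b j) : ℝ) + 1) -
        1 / Real.logb 2 ((position π j : ℝ) + 1)) := by
    rw [reviewerValue, reviewerValue, ← Finset.sum_sub_distrib]
    refine Finset.sum_congr rfl fun j _ => ?_
    simp only [position, Equiv.Perm.mul_apply]
    ring
  rw [Finset.sum_eq_add a b hab (fun j _ hj => by
    rw [Equiv.swap_apply_of_ne_of_ne hj.1 hj.2]; ring) (by simp) (by simp),
    Equiv.swap_apply_left, Equiv.swap_apply_right] at hsum
  linarith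

/-- An order read off from an optimal solution of the linear program maximizes the total weight
among all orders, since permutation matrices are feasible. -/
theorem IsOptimalOrder.sum_le {d : ℕ} {w : Fin d → Fin d → ℝ} {π : Equiv.Perm (Fin d)}
    (h : IsOptimalOrder w π) (σ : Equiv.Perm (Fin d)) : ∑ j, w j (σ j) ≤ ∑ j, w j (π j) := by
  obtain ⟨x, ⟨hx, hrow, -⟩, hopt, hπ⟩ := h
  have hx0 : ∀ j k, k ≠ π j → x j k = 0 := by
    intro j k hk
    have h1 := hrow j
    rw [← Finset.add_sum_erase _ _ (mem_univ (π j)), hπ j] at h1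
    have h2 : ∑ k ∈ univ.erase (π j), x j k = 0 := by linarith
    exact (Finset.sum_eq_zero_iff_of_nonneg fun k _ => (hx j k).1).1 h2 k (by simp [hk])
  have hxw : ∀ j, ∑ k, w j k * x j k = w j (π j) := by
    intro j
    rw [Finset.sum_eq_single (π j) (fun k _ hk => by rw [hx0 j k hk, mul_zero]) (by simp), hπ j,
      mul_one]
  have hσ : IsAssignment fun j k => if σ j = k then (1 : ℝ) else 0 := by
    refine ⟨fun j k => by dsimp only; split_ifs <;> simp, fun j => by simp, fun k => ?_⟩
    rw [Finset.sum_eq_single (σ.symm k)]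
    · simp
    · intro j _ hj
      refine if_neg ?_
      rintro rfl
      simp at hj
    · simp
  have := hopt _ hσ
  simpa [hxw] using this

/-! ### Community similarities and the bids they generate -/

section Community

variable {n m q : ℕ} {s ξ lam : ℝ} {rc pc : Fin n → Fin m} {S : Similarity n n}
  {ω : Fin n → Round n}

/-- A similarity matrix of community type: `rc i` is the community of reviewer `i` and `pc j` that
of paper `j`; each community consists of `q` reviewers and `q` papers. The similarities lie in
`(s - ξ, s)` within a community and in `(0, ξ)` across communities. -/
structure IsCommunity {n m : ℕ} (q : ℕ) (s ξ : ℝ) (rc pc : Fin n → Fin m)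
    (S : Similarity n n) : Prop where
  card_reviewers : ∀ c, (univ.filter fun i => rc i = c).card = q
  card_papers : ∀ c, (univ.filter fun j => pc j = c).card = q
  high : ∀ i j, rc i = pc j → s - ξ < S i j ∧ S i j < s
  low : ∀ i j, rc i ≠ pc j → 0 < S i j ∧ S i j < ξ
  le_level : 0.01 ≤ s
  level_le : s ≤ 1
  noise_pos : 0 < ξ
  noise_le : ξ ≤ 1 / 1000

/-- Each reviewer bids exactly on the paper shown on top if that paper is in the own community. -/
def BidsOnTop {n m : ℕ} (rc pc : Fin n → Fin m) (ω : Fin n → Round n) : Prop :=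
  ∀ i j, j ∈ (ω i).2 ↔ ((ω i).1 j : ℕ) = 0 ∧ rc i = pc j

/-- Paper `j` has no bid before the arrival of reviewer `i`. -/
def IsFresh {n : ℕ} (ω : Fin n → Round n) (i : Fin n) (j : Fin n) : Prop :=
  ∀ r < i, j ∉ (ω r).2

theorem IsCommunity.half_lt_iff (hC : IsCommunity q s ξ rc pc S) (i j : Fin n) :
    s / 2 < S i j ↔ rc i = pc j := by
  have h1 := hC.le_level
  have h2 := hC.noise_le
  constructor
  · intro h
    by_contra hne
    have := hC.low i j hne
    linarith
  · intro h
    have := hC.high i j h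
    linarith

theorem IsCommunity.bidsOnTop (hC : IsCommunity q s ξ rc pc S) {A : Policy n n}
    (h : trajectoryProb (thresholdModel s lam) A S ω ≠ 0) : BidsOnTop rc pc ω := by
  intro i j
  rw [mem_of_bidLaw_ne_zero (bidLaw_ne_zero_of_trajectoryProb_ne_zero h i) j, hC.half_lt_iff]

theorem bidCount_past_eq_zero_iff (i j : Fin n) : bidCount (past ω i) j = 0 ↔ IsFresh ω i j := by
  rw [bidCount, Finset.card_eq_zero, Finset.filter_eq_empty_iff]
  exact ⟨fun h r hr => @h ⟨r, hr⟩ (mem_univ _), fun h r _ => h _ (by exact r.isLt)⟩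

theorem BidsOnTop.eq_of_mem (hb : BidsOnTop rc pc ω) {i j j' : Fin n} (hj : j ∈ (ω i).2)
    (hj' : j' ∈ (ω i).2) : j = j' := by
  have h1 := ((hb i j).1 hj).1
  have h2 := ((hb i j').1 hj').1
  exact (ω i).1.injective (Fin.ext (h1.trans h2.symm))

theorem sum_bidCount (ω : Fin n → Round n) : ∑ j, bidCount ω j = ∑ i, (ω i).2.card := by
  have := Finset.sum_card_bipartiteAbove_eq_sum_card_bipartiteBelow
    (s := (univ : Finset (Fin n))) (t := (univ : Finset (Fin n))) (fun i j => j ∈ (ω i).2)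
  simp only [bipartiteAbove, bipartiteBelow] at this
  simpa [bidCount] using this.symm

theorem BidsOnTop.card_le_one (hb : BidsOnTop rc pc ω) (i : Fin n) : (ω i).2.card ≤ 1 :=
  Finset.card_le_one.2 fun _ hj _ hj' => hb.eq_of_mem hj hj'

theorem sqrt_natCast_le (k : ℕ) : √(k : ℝ) ≤ k := by
  rw [Real.sqrt_le_left (by positivity)]
  exact_mod_cast Nat.le_self_pow two_ne_zero k

theorem sum_sqrt_bidCount_le_sum_card (ω : Fin n → Round n) :
    ∑ j, √(bidCount ω j : ℝ) ≤ ∑ i, ((ω i).2.card : ℝ) := by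
  calc ∑ j, √(bidCount ω j : ℝ) ≤ ∑ j, (bidCount ω j : ℝ) :=
        Finset.sum_le_sum fun j _ => sqrt_natCast_le _
    _ = ∑ i, ((ω i).2.card : ℝ) := by exact_mod_cast sum_bidCount ω

theorem BidsOnTop.sum_sqrt_bidCount_le (hb : BidsOnTop rc pc ω) :
    ∑ j, √(bidCount ω j : ℝ) ≤ n := by
  refine (sum_sqrt_bidCount_le_sum_card ω).trans ?_
  calc ∑ i, ((ω i).2.card : ℝ) ≤ ∑ i : Fin n, (1 : ℝ) :=
        Finset.sum_le_sum fun i _ => by exact_mod_cast hb.card_le_one i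
    _ = n := by simp

/-- Papers of a set `P` that are not fresh have received bids from distinct reviewers. -/
theorem BidsOnTop.card_not_fresh_le (hb : BidsOnTop rc pc ω) (i : Fin n) (P : Fin m → Prop)
    [DecidablePred P] [DecidablePred (IsFresh ω i)] :
    (univ.filter fun j => P (pc j) ∧ ¬ IsFresh ω i j).card ≤
      (univ.filter fun r => r < i ∧ P (rc r)).card := by
  have h : ∀ j, ∃ r, ¬ IsFresh ω i j → r < i ∧ j ∈ (ω r).2 := by
    intro j
    by_cases hj : IsFresh ω i j
    · exact ⟨i, fun h => absurd hj h⟩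
    · simp only [IsFresh, not_forall, not_not] at hj
      obtain ⟨r, h1, h2⟩ := hj
      exact ⟨r, fun _ => ⟨h1, h2⟩⟩
  choose f hf using h
  refine Finset.card_le_card_of_injOn f ?_ ?_
  · intro j hj
    simp only [coe_filter, mem_univ, true_and, Set.mem_ofPred_eq] at hj ⊢
    have := hf j hj.2
    exact ⟨this.1, by rw [((hb _ _).1 this.2).2]; exact hj.1⟩
  · intro j hj j' hj' hjj
    simp only [coe_filter, mem_univ, true_and, Set.mem_ofPred_eq] at hj hj'
    have h1 := (hf j hj.2).2
    have h2 := (hf j' hj'.2).2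
    rw [← hjj] at h2
    exact hb.eq_of_mem h1 h2

/-- A community always has a fresh paper for an arriving member: fewer than `q` members have
arrived before, and each of them has bid on at most one paper. -/
theorem IsCommunity.exists_fresh (hC : IsCommunity q s ξ rc pc S) (hb : BidsOnTop rc pc ω)
    (i : Fin n) : ∃ j, rc i = pc j ∧ IsFresh ω i j := by
  classical
  by_contra! hno
  have h1 := hb.card_not_fresh_le i (fun c => c = rc i)
  have h2 : (univ.filter fun j => pc j = rc i ∧ ¬ IsFresh ω i j) =
      univ.filter fun j => pc j = rc i := by
    refine Finset.filter_congr fun j _ => ⟨fun h => h.1, fun h => ⟨h, hno j h.symm⟩⟩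
  have h3 : (univ.filter fun r => r < i ∧ rc r = rc i) ⊂ univ.filter fun r => rc r = rc i := by
    refine (Finset.ssubset_iff_of_subset fun r hr => ?_).2 ⟨i, by simp, by simp⟩
    simp only [mem_filter, mem_univ, true_and] at hr ⊢
    exact hr.2
  have h4 := Finset.card_lt_card h3
  rw [h2, hC.card_papers] at h1
  rw [hC.card_reviewers] at h4
  omega

/-- The top paper of each reviewer is a fresh paper of the own community. -/
def SeeksFresh (rc pc : Fin n → Fin m) (ω : Fin n → Round n) : Prop :=
  ∀ i, ∃ j, ((ω i).1 j : ℕ) = 0 ∧ rc i = pc j ∧ IsFresh ω i j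

/-- If all reviewers bid on fresh papers, then the `n` bids are on distinct papers. -/
theorem SeeksFresh.sum_sqrt_bidCount (hω : SeeksFresh rc pc ω) (hb : BidsOnTop rc pc ω) :
    ∑ j, √(bidCount ω j : ℝ) = n := by
  have hle : ∀ j, bidCount ω j ≤ 1 := by
    intro j
    refine Finset.card_le_one.2 fun r hr r' hr' => ?_
    simp only [mem_filter, mem_univ, true_and] at hr hr'
    have key : ∀ a b : Fin n, a < b → j ∈ (ω a).2 → j ∉ (ω b).2 := by
      intro a b hab ha hb'
      obtain ⟨t, h1, h2, h3⟩ := hω b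
      have : t ∈ (ω b).2 := (hb b t).2 ⟨h1, h2⟩
      rw [← hb.eq_of_mem hb' this] at h3
      exact h3 a hab ha
    rcases lt_trichotomy r r' with h | h | h
    · exact absurd hr' (key _ _ h hr)
    · exact h
    · exact absurd hr (key _ _ h hr')
  have hsq : ∀ j, √(bidCount ω j : ℝ) = (bidCount ω j : ℝ) := by
    intro j
    have := hle j
    interval_cases bidCount ω j <;> simp
  have hcard : ∀ i, (ω i).2.card = 1 := by
    intro i
    obtain ⟨t, h1, h2, -⟩ := hω i
    exact le_antisymm (hb.card_le_one i) (Finset.card_pos.2 ⟨t, (hb i t).2 ⟨h1, h2⟩⟩)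
  simp_rw [hsq]
  have := sum_bidCount ω
  simp only [hcard, sum_const, card_univ, Fintype.card_fin, smul_eq_mul, mul_one] at this
  exact_mod_cast this

/-! ### All policies, and SUPER* -/

/-- No policy gains more than one unit per reviewer on the paper side and the best reviewer-side
gain for each reviewer. -/
theorem IsCommunity.totalGain_le (hC : IsCommunity q s ξ rc pc S) (hlam : 0 ≤ lam) {A : Policy n n}
    (h : trajectoryProb (thresholdModel s lam) A S ω ≠ 0) :
    totalGain (thresholdModel s lam) S ω ≤ n + lam * ∑ i, bestValue (S i) := by
  rw [totalGain_thresholdModel]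
  have h1 := (hC.bidsOnTop h).sum_sqrt_bidCount_le
  have h2 := mul_le_mul_of_nonneg_left (Finset.sum_le_sum fun i (_ : i ∈ univ) =>
    reviewerValue_le_bestValue (S i) (ω i).1) hlam
  linarith

theorem IsCommunity.mem_Icc (hC : IsCommunity q s ξ rc pc S) (i j : Fin n) :
    S i j ∈ Set.Icc (0 : ℝ) 1 := by
  have h1 := hC.le_level
  have h2 := hC.noise_le
  have h3 := hC.level_le
  by_cases h : rc i = pc j
  · have := hC.high i j h
    constructor <;> linarith
  · have := hC.low i j h
    constructor <;> linarith

theorem IsCommunity.lt_level (hC : IsCommunity q s ξ rc pc S) (i j : Fin n) : S i j < s := by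
  have h1 := hC.le_level
  have h2 := hC.noise_le
  by_cases h : rc i = pc j
  · exact (hC.high i j h).2
  · linarith [(hC.low i j h).2]

/-- The largest loss of reviewer-side gain caused by moving a paper of the own community to the
top, see `IsCommunity.exists_top_of_high`. -/
def swapCost (n : ℕ) (ξ : ℝ) : ℝ := 7 / 5 * ξ * (1 - 1 / n)

/-- The bound is `log 2 * 2 * ξ`, rounded up. -/
theorem two_rpow_sub_le {x y ξ : ℝ} (hx : x ≤ 1) (hxy : x - ξ ≤ y) (hξ : 0 ≤ ξ) :
    (2 : ℝ) ^ x - 2 ^ y ≤ 7 / 5 * ξ := by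
  have h1 : (2 : ℝ) ^ (x - ξ) ≤ 2 ^ y := Real.rpow_le_rpow_of_exponent_le (by norm_num) hxy
  have h2 : (2 : ℝ) ^ (x - ξ) = 2 ^ x * 2 ^ (-ξ) := by
    rw [← Real.rpow_add two_pos, sub_eq_add_neg]
  have h3 : 1 - Real.log 2 * ξ ≤ (2 : ℝ) ^ (-ξ) := by
    rw [Real.rpow_def_of_pos two_pos]
    have := Real.add_one_le_exp (Real.log 2 * -ξ)
    linarith
  have h4 : (2 : ℝ) ^ x ≤ 2 := by
    simpa using Real.rpow_le_rpow_of_exponent_le (x := (2 : ℝ)) (by norm_num) hx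
  have h5 : (0 : ℝ) < 2 ^ x := Real.rpow_pos_of_pos two_pos _
  have h6 := Real.log_two_lt_d9
  have h7 := Real.log_two_gt_d9
  have h8 : (2 : ℝ) ^ x * (1 - Real.log 2 * ξ) ≤ 2 ^ x * 2 ^ (-ξ) :=
    mul_le_mul_of_nonneg_left h3 h5.le
  have h9 : (2 : ℝ) ^ x * (Real.log 2 * ξ) ≤ 2 * (Real.log 2 * ξ) :=
    mul_le_mul_of_nonneg_right h4 (by positivity)
  have h10 : Real.log 2 * ξ ≤ 7 / 10 * ξ := mul_le_mul_of_nonneg_right (by linarith) hξ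
  rw [h2] at h1
  linarith

theorem one_le_logb_two_add_one {k : ℝ} (hk : 1 ≤ k) : 1 ≤ Real.logb 2 (k + 1) := by
  rw [Real.le_logb_iff_rpow_le (by norm_num) (by linarith)]
  norm_num
  linarith

theorem logb_two_add_one_le (k : ℕ) : Real.logb 2 ((k : ℝ) + 1) ≤ k := by
  rw [Real.logb_le_iff_le_rpow (by norm_num) (by positivity), Real.rpow_natCast]
  exact_mod_cast Nat.lt_two_pow_self

theorem exists_apply_eq_zero {n : ℕ} (i : Fin n) (π : Equiv.Perm (Fin n)) :
    ∃ j, (π j : ℕ) = 0 :=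
  ⟨π.symm ⟨0, i.pos⟩, by simp⟩

/-- Any paper of the own community can be moved to the top of a best ordering at the cost
`swapCost n ξ`. The factor `1 - 1 / n` in this cost comes from `log₂(k + 1) ≤ k ≤ n` for the
position `k` of the paper that is moved down. -/
theorem IsCommunity.exists_top_of_high (hC : IsCommunity q s ξ rc pc S) {i j : Fin n}
    (hj : rc i = pc j) :
    ∃ σ : Equiv.Perm (Fin n), (σ j : ℕ) = 0 ∧
      bestValue (S i) - swapCost n ξ ≤ reviewerValue (S i) σ := by
  have hn : (1 : ℝ) ≤ n := by exact_mod_cast i.pos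
  have hn' : 1 / (n : ℝ) ≤ 1 := by rw [div_le_one (by linarith)]; exact hn
  have hξ := hC.noise_pos
  have hcost : 0 ≤ swapCost n ξ := by
    rw [swapCost]
    exact mul_nonneg (by positivity) (by linarith)
  obtain ⟨π, hπ⟩ := exists_reviewerValue_eq_bestValue (S i)
  obtain ⟨a, ha⟩ := exists_apply_eq_zero i π
  by_cases haj : a = j
  · exact ⟨π, haj ▸ ha, by linarith⟩
  refine ⟨π * Equiv.swap a j, by simpa using ha, ?_⟩
  rw [reviewerValue_mul_swap _ _ haj, hπ]
  have h0 : Real.logb 2 ((position π a : ℝ) + 1) = 1 := by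
    rw [position, ha]
    norm_num
  rw [h0]
  have hpos : (1 : ℝ) ≤ position π j := by simp [position]
  have hle : (position π j : ℝ) ≤ n := by
    exact_mod_cast (π j).isLt
  have h1 := one_le_logb_two_add_one hpos
  have h2 : 1 / (n : ℝ) ≤ 1 / Real.logb 2 ((position π j : ℝ) + 1) :=
    one_div_le_one_div_of_le (by linarith) ((logb_two_add_one_le _).trans hle)
  have h3 : 1 / Real.logb 2 ((position π j : ℝ) + 1) ≤ 1 := by
    rw [div_le_one (by linarith)]
    exact h1
  have h4 : (2 : ℝ) ^ S i a - 2 ^ S i j ≤ 7 / 5 * ξ :=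
    two_rpow_sub_le (hC.mem_Icc i a).2
      (by linarith [(hC.high i j hj).1, hC.lt_level i a]) hξ.le
  have h5 : ((2 : ℝ) ^ S i a - 2 ^ S i j) * (1 - 1 / Real.logb 2 ((position π j : ℝ) + 1)) ≤
      7 / 5 * ξ * (1 - 1 / n) := by
    refine (mul_le_mul_of_nonneg_right h4 (by linarith)).trans ?_
    exact mul_le_mul_of_nonneg_left (by linarith) (by positivity)
  rw [swapCost]
  linarith

theorem sqrt_succ_sub_sqrt_le {k : ℕ} (hk : k ≠ 0) : √((k : ℝ) + 1) - √(k : ℝ) ≤ 1 / 2 := by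
  have hk1 : (1 : ℝ) ≤ k := by exact_mod_cast Nat.one_le_iff_ne_zero.2 hk
  have h1 : 1 ≤ √(k : ℝ) := Real.one_le_sqrt.2 hk1
  have h2 := Real.sq_sqrt (show (0 : ℝ) ≤ k by linarith)
  have : √((k : ℝ) + 1) ≤ √(k : ℝ) + 1 / 2 := Real.sqrt_le_iff.2 ⟨by linarith, by nlinarith⟩
  linarith

/-- The objective of the linear program of SUPER* for the order `π` with top paper `a`. -/
theorem IsCommunity.sum_superWeight (hC : IsCommunity q s ξ rc pc S) (i : Fin n) (g : Fin n → ℕ)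
    {π : Equiv.Perm (Fin n)} {a : Fin n} (ha : (π a : ℕ) = 0) :
    ∑ j, superWeight (thresholdModel s lam) (S i) g 0 j (π j) =
      lam * reviewerValue (S i) π + if rc i = pc a then √((g a : ℝ) + 1) - √(g a : ℝ) else 0 := by
  simp only [superWeight, Finset.sum_add_distrib, ← Finset.mul_sum]
  congr 1
  rw [Finset.sum_eq_single a]
  · simp [thresholdModel, ha, hC.half_lt_iff]
  · intro j _ hj
    have : ¬ ((π j : ℕ) + 1 = 1 ∧ s / 2 < S i j) := by
      rintro ⟨h, -⟩
      exact hj (π.injective (Fin.ext (by omega)))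
    simp only [thresholdModel, this, if_false, zero_mul]
  · simp

/-- A fresh paper on top adds `1` to the objective of SUPER*, a paper with bids at most `1 / 2`, and
the exchange that brings a fresh paper to the top costs less than the difference. -/
theorem IsCommunity.top_of_isOptimalOrder (hC : IsCommunity q s ξ rc pc S)
    (hlam : 0 ≤ lam) (hcost : lam * swapCost n ξ < 1 / 2) {i : Fin n} {g : Fin n → ℕ}
    (hg : ∃ j, rc i = pc j ∧ g j = 0) {π : Equiv.Perm (Fin n)}
    (hπ : IsOptimalOrder (superWeight (thresholdModel s lam) (S i) g 0) π) :
    (∃ j, (π j : ℕ) = 0 ∧ rc i = pc j ∧ g j = 0) ∧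
      lam * (bestValue (S i) - swapCost n ξ) ≤ lam * reviewerValue (S i) π := by
  obtain ⟨j, hj, hgj⟩ := hg
  obtain ⟨σ, hσ, hval⟩ := hC.exists_top_of_high hj
  obtain ⟨a, ha⟩ := exists_apply_eq_zero i π
  have h1 := hπ.sum_le σ
  rw [hC.sum_superWeight i g hσ, hC.sum_superWeight i g ha, if_pos hj, hgj] at h1
  have h2 := mul_le_mul_of_nonneg_left hval hlam
  have h3 := mul_le_mul_of_nonneg_left (reviewerValue_le_bestValue (S i) π) hlam
  rw [mul_sub] at h2 ⊢
  norm_num at h1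
  by_cases hac : rc i = pc a ∧ g a = 0
  · refine ⟨⟨a, ha, hac⟩, ?_⟩
    rw [if_pos hac.1, hac.2] at h1
    norm_num at h1
    linarith
  · exfalso
    have : (if rc i = pc a then √((g a : ℝ) + 1) - √(g a : ℝ) else 0) ≤ 1 / 2 := by
      split_ifs with h
      · exact sqrt_succ_sub_sqrt_le fun h' => hac ⟨h, h'⟩
      · norm_num
    linarith

/-- SUPER* is optimal up to the cost of one exchange per reviewer. -/
theorem IsCommunity.le_totalGain_superStar (hC : IsCommunity q s ξ rc pc S)
    (hlam : 0 ≤ lam) (hcost : lam * swapCost n ξ < 1 / 2) {A : Policy n n}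
    (hA : IsSuperStar (thresholdModel s lam) (zeroHeuristic n n) A)
    (h : trajectoryProb (thresholdModel s lam) A S ω ≠ 0) :
    n + lam * ∑ i, bestValue (S i) - lam * (n * swapCost n ξ) ≤
      totalGain (thresholdModel s lam) S ω := by
  have hb := hC.bidsOnTop h
  have key := fun i => hC.top_of_isOptimalOrder hlam hcost (g := bidCount (past ω i))
    (by simpa only [bidCount_past_eq_zero_iff] using hC.exists_fresh hb i)
    (hA S hC.mem_Icc i (past ω i) _ (prob_ne_zero_of_trajectoryProb_ne_zero h i))
  simp only [bidCount_past_eq_zero_iff] at key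
  have hsum := Finset.sum_le_sum fun i (_ : i ∈ univ) => (key i).2
  rw [totalGain_thresholdModel, SeeksFresh.sum_sqrt_bidCount (fun i => (key i).1) hb]
  simp only [← Finset.mul_sum, Finset.sum_sub_distrib, sum_const, card_univ, Fintype.card_fin,
    nsmul_eq_mul, mul_sub] at hsum
  linarith

/-! ### BID -/

theorem bidPolicy_sorted {n d : ℕ} {S : Similarity n d} {i : Fin n}
    {h : Fin (i : ℕ) → Round d} {π : Equiv.Perm (Fin d)}
    (hπ : (bidPolicy n d).prob S i h π ≠ 0) {j j' : Fin d} (hj : π j < π j') :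
    bidCount h j < bidCount h j' ∨ bidCount h j = bidCount h j' ∧ S i j' ≤ S i j := by
  simp only [bidPolicy, sortPolicy, sortedOrders] at hπ
  have h1 := (ne_eq _ _ ▸ hπ : ¬ _ = _)
  rw [ite_eq_right_iff, Classical.not_imp] at h1
  have h2 := (mem_filter.1 h1.1).2 j j' hj
  simpa [Prod.Lex.toLex_le_toLex] using h2

theorem simPolicy_sorted {n d : ℕ} {S : Similarity n d} {i : Fin n}
    {h : Fin (i : ℕ) → Round d} {π : Equiv.Perm (Fin d)}
    (hπ : (simPolicy n d).prob S i h π ≠ 0) {j j' : Fin d} (hj : π j < π j') :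
    S i j' ≤ S i j := by
  simp only [simPolicy, sortPolicy, sortedOrders] at hπ
  have h1 := (ne_eq _ _ ▸ hπ : ¬ _ = _)
  rw [ite_eq_right_iff, Classical.not_imp] at h1
  have h2 := (mem_filter.1 h1.1).2 j j' hj
  simp only [Prod.Lex.toLex_le_toLex, OrderDual.toDual_lt_toDual, OrderDual.toDual_inj] at h2
  rcases h2 with h2 | h2
  · exact h2.le
  · exact h2.1.ge

theorem lt_of_apply_eq_zero {n : ℕ} {π : Equiv.Perm (Fin n)} {a j : Fin n} (ha : (π a : ℕ) = 0)
    (haj : a ≠ j) : π a < π j := by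
  have : (π a : ℕ) ≠ π j := fun h => haj (π.injective (Fin.ext h))
  rw [Fin.lt_def]
  omega

/-- BID shows a paper without bids on top, and prefers those of the own community, of which there
is one. -/
theorem IsCommunity.seeksFresh_bidPolicy (hC : IsCommunity q s ξ rc pc S)
    (h : trajectoryProb (thresholdModel s lam) (bidPolicy n n) S ω ≠ 0) :
    SeeksFresh rc pc ω := by
  intro i
  obtain ⟨j, hj, hf⟩ := hC.exists_fresh (hC.bidsOnTop h) i
  obtain ⟨a, ha⟩ := exists_apply_eq_zero i (ω i).1
  refine ⟨a, ha, ?_⟩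
  by_cases haj : a = j
  · exact haj ▸ ⟨hj, hf⟩
  have hs := bidPolicy_sorted (prob_ne_zero_of_trajectoryProb_ne_zero h i)
    (lt_of_apply_eq_zero ha haj)
  rw [(bidCount_past_eq_zero_iff i j).2 hf] at hs
  obtain ⟨h1, h2⟩ := hs.resolve_left (by omega)
  refine ⟨(hC.half_lt_iff i a).1 ?_, (bidCount_past_eq_zero_iff i a).1 h1⟩
  have := (hC.half_lt_iff i j).2 hj
  linarith

/-- A lower bound, for noise below `ξ`, for the reviewer-side loss caused by a paper of the own
community at a position behind `q + B - 1`: it could be exchanged with a paper of another community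
among the first `q`. -/
def displacementLoss (q B : ℕ) (s ξ : ℝ) : ℝ :=
  ((2 : ℝ) ^ (s - ξ) - 2 ^ ξ) *
    (1 / Real.logb 2 ((q : ℝ) + 1) - 1 / Real.logb 2 ((q : ℝ) + B + 1))

theorem one_div_logb_le_one_div_logb {x y : ℝ} (hx : 1 ≤ x) (hxy : x ≤ y) :
    1 / Real.logb 2 (y + 1) ≤ 1 / Real.logb 2 (x + 1) :=
  one_div_le_one_div_of_le (by linarith [one_le_logb_two_add_one hx])
    (Real.logb_le_logb_of_le (by norm_num) (by linarith) (by linarith))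

theorem two_rpow_noise_le (hs : 0.01 ≤ s) (hξ : ξ ≤ 1 / 1000) :
    (2 : ℝ) ^ ξ ≤ 2 ^ (s - ξ) :=
  Real.rpow_le_rpow_of_exponent_le (by norm_num) (by linarith)

theorem IsCommunity.displacementLoss_nonneg (hC : IsCommunity q s ξ rc pc S) (hq : 1 ≤ q) (B : ℕ) :
    0 ≤ displacementLoss q B s ξ := by
  have hq' : (1 : ℝ) ≤ q := by exact_mod_cast hq
  exact mul_nonneg (sub_nonneg.2 (two_rpow_noise_le hC.le_level hC.noise_le))
    (sub_nonneg.2 (one_div_logb_le_one_div_logb hq' (by simp)))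

/-- If a paper of the own community is shown at position `q + B` or later, then a paper of another
community is among the first `q`, and exchanging the two is an improvement. -/
theorem IsCommunity.displacementLoss_le (hC : IsCommunity q s ξ rc pc S) {B : ℕ}
    (hB : 1 ≤ B) (hqn : q ≤ n) {i : Fin n} {π : Equiv.Perm (Fin n)} {j : Fin n}
    (hj : rc i = pc j) (hpos : q + B ≤ position π j) :
    reviewerValue (S i) π ≤ bestValue (S i) - displacementLoss q B s ξ := by
  obtain ⟨k, hk, hkq⟩ : ∃ k, rc i ≠ pc k ∧ position π k ≤ q := by
    by_contra! hno
    let T : Finset (Fin n) := univ.image fun t : Fin q => π.symm (Fin.castLE hqn t)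
    have hT : T.card = q :=
      (Finset.card_image_of_injective univ
        (π.symm.injective.comp (Fin.castLE_injective hqn))).trans (by simp)
    have hsub : T ⊆ univ.filter fun k => pc k = rc i := by
      intro k hk
      obtain ⟨t, -, rfl⟩ := mem_image.1 hk
      refine mem_filter.2 ⟨mem_univ _, ?_⟩
      by_contra hne
      have := hno _ (Ne.symm hne)
      simp only [position, Equiv.apply_symm_apply, Fin.val_castLE] at this
      omega
    have heq := Finset.eq_of_subset_of_card_le hsub (by rw [hC.card_papers, hT])
    have hjT : j ∈ T := by
      rw [heq]
      simp [hj]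
    obtain ⟨t, -, rfl⟩ := mem_image.1 hjT
    simp only [position, Equiv.apply_symm_apply, Fin.val_castLE] at hpos
    omega
  have hjk : j ≠ k := by
    rintro rfl
    exact hk hj
  have h1 := reviewerValue_le_bestValue (S i) (π * Equiv.swap j k)
  rw [reviewerValue_mul_swap _ _ hjk] at h1
  have hk1 : (1 : ℝ) ≤ position π k := by simp [position]
  have hkq' : (position π k : ℝ) ≤ q := by exact_mod_cast hkq
  have hpos' : (q : ℝ) + B ≤ position π j := by exact_mod_cast hpos
  have hB' : (1 : ℝ) ≤ B := by exact_mod_cast hB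
  have h2 := one_div_logb_le_one_div_logb hk1 hkq'
  have h3 := one_div_logb_le_one_div_logb (by linarith) hpos'
  have h4 := one_div_logb_le_one_div_logb (x := q) (y := q + B) (by linarith) (by linarith)
  have h5 : (2 : ℝ) ^ (s - ξ) ≤ 2 ^ S i j :=
    Real.rpow_le_rpow_of_exponent_le (by norm_num) (hC.high i j hj).1.le
  have h6 : (2 : ℝ) ^ S i k ≤ 2 ^ ξ :=
    Real.rpow_le_rpow_of_exponent_le (by norm_num) (hC.low i k hk).2.le
  have h7 := two_rpow_noise_le hC.le_level hC.noise_le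
  have h8 : displacementLoss q B s ξ ≤ ((2 : ℝ) ^ S i j - 2 ^ S i k) *
      (1 / Real.logb 2 ((position π k : ℝ) + 1) - 1 / Real.logb 2 ((position π j : ℝ) + 1)) :=
    mul_le_mul (by linarith) (by linarith) (by linarith) (by linarith)
  linarith

/-- Once a member of its community has arrived before, reviewer `i` finds a paper with a bid in the
own community, and BID shows it behind the fresh papers of all other communities. -/
theorem IsCommunity.reviewerValue_bidPolicy_le (hC : IsCommunity q s ξ rc pc S)
    (h : trajectoryProb (thresholdModel s lam) (bidPolicy n n) S ω ≠ 0) {B : ℕ} (hB : 1 ≤ B)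
    (hqn : q ≤ n) {i : Fin n} (hi : ∃ r < i, rc r = rc i) (hiB : q + i + B ≤ n + 1) :
    reviewerValue (S i) (ω i).1 ≤ bestValue (S i) - displacementLoss q B s ξ := by
  classical
  have hb := hC.bidsOnTop h
  have hsorted := fun j j' => @bidPolicy_sorted n n S i (past ω i) (ω i).1
    (prob_ne_zero_of_trajectoryProb_ne_zero h i) j j'
  obtain ⟨r, hri, hr⟩ := hi
  obtain ⟨t, ht1, ht2, -⟩ := hC.seeksFresh_bidPolicy h r
  have ht : bidCount (past ω i) t ≠ 0 := by
    rw [Ne, bidCount_past_eq_zero_iff]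
    exact fun hf => hf r hri ((hb r t).2 ⟨ht1, ht2⟩)
  obtain ⟨j, hjC, hjmax⟩ := Finset.exists_max_image (univ.filter fun j => pc j = rc i) (ω i).1
    ⟨t, by simp [← ht2, hr]⟩
  simp only [mem_filter, mem_univ, true_and] at hjC hjmax
  have hj : bidCount (past ω i) j ≠ 0 := by
    by_cases hjt : t = j
    · exact hjt ▸ ht
    · have hle := hjmax t (by rw [← ht2, hr])
      have := hsorted t j (lt_of_le_of_ne hle fun h => hjt ((ω i).1.injective h))
      omega
  refine hC.displacementLoss_le hB hqn hjC.symm ?_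
  -- the papers of the own community, and the fresh ones of the others, are not behind `j`
  have h1 : ((univ.filter fun k => pc k = rc i) ∪
      univ.filter fun k => pc k ≠ rc i ∧ IsFresh ω i k).card ≤ position (ω i).1 j := by
    rw [position, ← Fin.card_Iic]
    refine Finset.card_le_card_of_injOn (ω i).1 ?_ (ω i).1.injective.injOn
    intro k hk
    simp only [coe_union, coe_filter, mem_univ, true_and, Set.mem_union, Set.mem_ofPred_eq] at hk
    simp only [coe_Iic, Set.mem_Iic]
    rcases hk with hk | ⟨-, hk⟩
    · exact hjmax k hk
    · by_contra hlt
      have := hsorted j k (not_le.1 hlt)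
      rw [(bidCount_past_eq_zero_iff i k).2 hk] at this
      omega
  rw [Finset.card_union_of_disjoint (Finset.disjoint_filter.2 fun k _ hk hk' => hk'.1 hk),
    hC.card_papers] at h1
  have h2 := Finset.card_filter_add_card_filter_not (s := univ.filter fun k => pc k ≠ rc i)
    (IsFresh ω i)
  have h3 := Finset.card_filter_add_card_filter_not (s := (univ : Finset (Fin n)))
    (fun k => pc k = rc i)
  have h4 := hb.card_not_fresh_le i (fun c => c ≠ rc i)
  have h5 : (univ.filter fun r => r < i ∧ rc r ≠ rc i).card < i := by
    rw [← Fin.card_Iio i]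
    refine Finset.card_lt_card ((Finset.ssubset_iff_of_subset fun r hr => ?_).2
      ⟨r, by simpa using hri, by simp [hr]⟩)
    simp only [mem_filter, mem_univ, true_and] at hr
    simpa using hr.1
  rw [Finset.filter_filter, Finset.filter_filter] at h2
  rw [hC.card_papers, card_univ, Fintype.card_fin] at h3
  simp only [ne_eq] at h1 h2 h3 h4 h5 ⊢
  omega

/-- Among the first `L + 1` reviewers all but `m` have an earlier member in their community. -/
theorem card_repeated_community (rc : Fin n → Fin m) {L : ℕ} (hL : L < n) :
    L + 1 ≤ (univ.filter fun i : Fin n => (i : ℕ) ≤ L ∧ ∃ r < i, rc r = rc i).card + m := by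
  have h1 : (univ.filter fun i : Fin n => (i : ℕ) ≤ L).card = L + 1 := by
    have : (univ.filter fun i : Fin n => (i : ℕ) ≤ L) = Finset.Iic ⟨L, hL⟩ := by
      ext i
      simp [Fin.le_def]
    rw [this, Fin.card_Iic]
  have h2 := Finset.card_filter_add_card_filter_not
    (s := univ.filter fun i : Fin n => (i : ℕ) ≤ L) (fun i => ∃ r < i, rc r = rc i)
  have h3 : ((univ.filter fun i : Fin n => (i : ℕ) ≤ L).filter
      fun i => ¬ ∃ r < i, rc r = rc i).card ≤ m := by
    have := Finset.card_le_card_of_injOn (t := (univ : Finset (Fin m))) rc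
      (s := (univ.filter fun i : Fin n => (i : ℕ) ≤ L).filter fun i => ¬ ∃ r < i, rc r = rc i)
      (fun _ _ => mem_coe.2 (mem_univ _)) ?_
    · simpa using this
    · intro a ha b hb hab
      simp only [not_exists, not_and, coe_filter, mem_filter, mem_univ, true_and,
        Set.mem_ofPred_eq] at ha hb
      rcases lt_trichotomy a b with hlt | heq | hlt
      · exact absurd hab (hb.2 a hlt)
      · exact heq
      · exact absurd hab.symm (ha.2 b hlt)
  rw [Finset.filter_filter, Finset.filter_filter] at h2
  rw [Finset.filter_filter] at h3
  omega

theorem IsCommunity.totalGain_bidPolicy_le (hC : IsCommunity q s ξ rc pc S) (hlam : 0 ≤ lam)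
    (h : trajectoryProb (thresholdModel s lam) (bidPolicy n n) S ω ≠ 0) {B L K : ℕ} (hB : 1 ≤ B)
    (hq : 1 ≤ q) (hqn : q ≤ n) (hL : L < n) (hLB : q + L + B ≤ n + 1) (hK : m + K ≤ L + 1) :
    totalGain (thresholdModel s lam) S ω ≤
      n + lam * ∑ i, bestValue (S i) - lam * (K * displacementLoss q B s ξ) := by
  have h1 := (hC.bidsOnTop h).sum_sqrt_bidCount_le
  have h2 : ∑ i, reviewerValue (S i) (ω i).1 ≤ ∑ i, (bestValue (S i) -
      if (i : ℕ) ≤ L ∧ ∃ r < i, rc r = rc i then displacementLoss q B s ξ else 0) := by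
    refine Finset.sum_le_sum fun i _ => ?_
    split_ifs with hi
    · exact hC.reviewerValue_bidPolicy_le h hB hqn hi.2 (by omega)
    · simpa using reviewerValue_le_bestValue (S i) (ω i).1
  rw [Finset.sum_sub_distrib, ← Finset.sum_filter, Finset.sum_const, nsmul_eq_mul] at h2
  have h3 : (K : ℝ) * displacementLoss q B s ξ ≤
      ((univ.filter fun i : Fin n => (i : ℕ) ≤ L ∧ ∃ r < i, rc r = rc i).card : ℝ) *
        displacementLoss q B s ξ := by
    refine mul_le_mul_of_nonneg_right ?_ (hC.displacementLoss_nonneg hq B)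
    have := card_repeated_community rc hL
    exact_mod_cast (by omega : K ≤ _)
  have h4 := mul_le_mul_of_nonneg_left (h2.trans (sub_le_sub_left h3 _)) hlam
  rw [mul_sub] at h4
  rw [totalGain_thresholdModel]
  linarith

/-! ### SIM -/

/-- A paper for which each member of its community has a better paper: SIM never gets a bid
on it. -/
def IsDominated (rc pc : Fin n → Fin m) (S : Similarity n n) (j : Fin n) : Prop :=
  ∀ i, rc i = pc j → ∃ k, pc k = pc j ∧ S i j < S i k

open Classical in
theorem IsCommunity.totalGain_simPolicy_le (hC : IsCommunity q s ξ rc pc S) (hlam : 0 ≤ lam)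
    (h : trajectoryProb (thresholdModel s lam) (simPolicy n n) S ω ≠ 0) :
    totalGain (thresholdModel s lam) S ω ≤ n + lam * ∑ i, bestValue (S i) -
      1 / 2 * ∑ j, if IsDominated rc pc S j then 1 else 0 := by
  have hb := hC.bidsOnTop h
  have h0 : ∀ j, IsDominated rc pc S j → bidCount ω j = 0 := by
    intro j hj
    rw [bidCount, Finset.card_eq_zero, Finset.filter_eq_empty_iff]
    intro i _ hi
    obtain ⟨hi0, hic⟩ := (hb i j).1 hi
    obtain ⟨k, -, hlt⟩ := hj i hic
    have hjk : j ≠ k := by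
      rintro rfl
      exact lt_irrefl _ hlt
    exact absurd (simPolicy_sorted (prob_ne_zero_of_trajectoryProb_ne_zero h i)
      (lt_of_apply_eq_zero hi0 hjk)) (not_le.2 hlt)
  have h1 : ∑ j, √(bidCount ω j : ℝ) ≤
      ∑ j, (1 / 2 * (bidCount ω j : ℝ) + 1 / 2 -
        1 / 2 * if IsDominated rc pc S j then 1 else 0) := by
    refine Finset.sum_le_sum fun j _ => ?_
    split_ifs with hj
    · simp [h0 j hj]
    -- `√g ≤ (g + 1) / 2` is the inequality of the means; it wastes `1 / 2` at `g = 0`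
    · nlinarith [sq_nonneg (√(bidCount ω j : ℝ) - 1),
        Real.sq_sqrt (Nat.cast_nonneg (α := ℝ) (bidCount ω j))]
  have h2 : ∑ j, (bidCount ω j : ℝ) ≤ n := by
    have : ∑ j, bidCount ω j ≤ n := by
      rw [sum_bidCount]
      simpa using Finset.sum_le_card_nsmul univ _ 1 fun i _ => hb.card_le_one i
    exact_mod_cast this
  have h3 := mul_le_mul_of_nonneg_left (Finset.sum_le_sum fun i (_ : i ∈ univ) =>
    reviewerValue_le_bestValue (S i) (ω i).1) hlam
  rw [Finset.sum_sub_distrib, Finset.sum_add_distrib, ← Finset.mul_sum, ← Finset.mul_sum] at h1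
  simp only [sum_const, card_univ, Fintype.card_fin, nsmul_eq_mul] at h1
  rw [totalGain_thresholdModel]
  linarith

/-! ### RAND -/

theorem card_perm_apply_eq_zero {n : ℕ} (j : Fin n) :
    (univ.filter fun π : Equiv.Perm (Fin n) => (π j : ℕ) = 0).card * n = n.factorial := by
  have h1 : ∀ k, (univ.filter fun π : Equiv.Perm (Fin n) => (π k : ℕ) = 0).card =
      (univ.filter fun π : Equiv.Perm (Fin n) => (π j : ℕ) = 0).card := by
    intro k
    refine Finset.card_bij (fun π _ => π * Equiv.swap j k) ?_ ?_ ?_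
    · intro π hπ
      simpa using hπ
    · intro π _ π' _ h
      exact mul_right_cancel h
    · intro π hπ
      exact ⟨π * Equiv.swap j k, by simpa using hπ, by simp [mul_assoc]⟩
  have h2 : ∀ π : Equiv.Perm (Fin n), (univ.filter fun k => (π k : ℕ) = 0).card = 1 := by
    intro π
    obtain ⟨a, ha⟩ := exists_apply_eq_zero j π
    rw [Finset.card_eq_one]
    refine ⟨a, ?_⟩
    ext k
    simp only [mem_filter, mem_univ, true_and, mem_singleton]
    exact ⟨fun hk => π.injective (Fin.ext (hk.trans ha.symm)), fun h => h ▸ ha⟩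
  have h3 := Finset.sum_card_bipartiteAbove_eq_sum_card_bipartiteBelow
    (s := (univ : Finset (Equiv.Perm (Fin n)))) (t := (univ : Finset (Fin n)))
    (fun π k => (π k : ℕ) = 0)
  simp only [bipartiteAbove, bipartiteBelow, h1, h2, sum_const, card_univ, Fintype.card_perm,
    Fintype.card_fin, smul_eq_mul, mul_one] at h3
  rw [h3, mul_comm]

/-- The bids are a function of the ordering: the top paper, if it is in the own community. -/
theorem IsCommunity.sum_bidLaw_mul_card (hC : IsCommunity q s ξ rc pc S) (i : Fin n)
    (π : Equiv.Perm (Fin n)) :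
    ∑ b, bidLaw (thresholdModel s lam) (S i) π b * (b.card : ℝ) =
      ∑ j ∈ univ.filter fun j => pc j = rc i, if (π j : ℕ) = 0 then 1 else 0 := by
  have h1 : ∀ b, bidLaw (thresholdModel s lam) (S i) π b * (b.card : ℝ) =
      bidLaw (thresholdModel s lam) (S i) π b *
        ∑ j ∈ univ.filter fun j => pc j = rc i, if (π j : ℕ) = 0 then 1 else 0 := by
    intro b
    by_cases hb : bidLaw (thresholdModel s lam) (S i) π b = 0
    · simp [hb]
    · congr 1
      have : b = (univ.filter fun j => pc j = rc i).filter fun j => (π j : ℕ) = 0 := by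
        ext j
        rw [mem_of_bidLaw_ne_zero hb, hC.half_lt_iff]
        simp [and_comm, eq_comm]
      rw [Finset.sum_boole, ← this]
  simp_rw [h1, ← Finset.sum_mul, sum_bidLaw, one_mul]

/-- Under RAND each reviewer bids with probability `q / n`. -/
theorem IsCommunity.expectedGain_randPolicy_le (hC : IsCommunity q s ξ rc pc S) (hlam : 0 ≤ lam)
    (hqn : 2 * q ≤ n) :
    expectedGain (thresholdModel s lam) (randPolicy n n) S ≤
      n / 2 + lam * ∑ i, bestValue (S i) := by
  have hM := thresholdModel_bidProb_mem s lam
  have h1 := sum_trajectoryProb_mul_le hM (randPolicy n n) S (fun _ r => (r.2.card : ℝ))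
    (fun _ => 1 / 2) (by
      intro i h
      simp_rw [hC.sum_bidLaw_mul_card]
      simp only [randPolicy]
      rw [← Finset.mul_sum, Finset.sum_comm]
      simp_rw [Finset.sum_boole]
      have hcard : ∀ j, ((univ.filter fun π : Equiv.Perm (Fin n) => (π j : ℕ) = 0).card : ℝ) =
          n.factorial / n := by
        intro j
        have hn : (n : ℝ) ≠ 0 := Nat.cast_ne_zero.2 i.pos.ne'
        rw [eq_div_iff hn]
        exact_mod_cast card_perm_apply_eq_zero j
      simp_rw [hcard]
      rw [Finset.sum_const, hC.card_papers, nsmul_eq_mul]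
      have hf : (0 : ℝ) < n.factorial := by exact_mod_cast n.factorial_pos
      have hn : (0 : ℝ) < n := by exact_mod_cast i.pos
      have hq : 2 * (q : ℝ) ≤ n := by exact_mod_cast hqn
      rw [show ((n.factorial : ℝ))⁻¹ * (q * (n.factorial / n)) = q / n by field_simp,
        div_le_div_iff₀ hn two_pos]
      linarith)
  calc expectedGain (thresholdModel s lam) (randPolicy n n) S
      ≤ ∑ ω, (trajectoryProb (thresholdModel s lam) (randPolicy n n) S ω *
          ∑ i, ((ω i).2.card : ℝ) +
        trajectoryProb (thresholdModel s lam) (randPolicy n n) S ω *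
          (lam * ∑ i, bestValue (S i))) := by
        refine Finset.sum_le_sum fun ω _ => ?_
        rw [← mul_add]
        refine mul_le_mul_of_nonneg_left ?_ (trajectoryProb_nonneg hM _ _ _)
        rw [totalGain_thresholdModel]
        exact add_le_add (sum_sqrt_bidCount_le_sum_card ω) (mul_le_mul_of_nonneg_left
          (Finset.sum_le_sum fun i _ => reviewerValue_le_bestValue (S i) (ω i).1) hlam)
    _ ≤ n / 2 + lam * ∑ i, bestValue (S i) := by
        rw [Finset.sum_add_distrib, ← Finset.sum_mul, sum_trajectoryProb hM, one_mul]
        refine add_le_add_left (h1.trans_eq ?_) _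
        simp
        ring

end Community

/-! ### The noise -/

section Noise

theorem measurableSet_forall_mem_le {ι : Type*} (C : Finset ι) (k : ι) :
    MeasurableSet {x : ι → ℝ | ∀ j ∈ C, x k ≤ x j} := by
  have : {x : ι → ℝ | ∀ j ∈ C, x k ≤ x j} = ⋂ j ∈ C, {x | x k ≤ x j} := by
    ext x
    simp
  rw [this]
  exact Finset.measurableSet_biInter _ fun j _ =>
    measurableSet_le (measurable_pi_apply k) (measurable_pi_apply j)

variable {ι : Type*} [Fintype ι] (μ : Measure ℝ) [IsProbabilityMeasure μ]

theorem pi_eval_eq_eval_null [NullSingletonClass μ] {a b : ι} (hab : a ≠ b) :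
    Measure.pi (fun _ : ι => μ) {x | x a = x b} = 0 := by
  have hind := (ProbabilityTheory.iIndepFun_pi (μ := fun _ : ι => μ) (X := fun _ x => x)
    fun _ => aemeasurable_id).indepFun hab
  rw [ProbabilityTheory.indepFun_iff_map_prod_eq_prod_map_map
    (measurable_pi_apply a).aemeasurable (measurable_pi_apply b).aemeasurable] at hind
  have ha : Measure.map (fun x : ι → ℝ => x a) (Measure.pi fun _ => μ) = μ :=
    (measurePreserving_eval (fun _ : ι => μ) a).map_eq
  have hb : Measure.map (fun x : ι → ℝ => x b) (Measure.pi fun _ => μ) = μ :=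
    (measurePreserving_eval (fun _ : ι => μ) b).map_eq
  rw [ha, hb] at hind
  have hD : MeasurableSet {p : ℝ × ℝ | p.1 = p.2} :=
    measurableSet_eq_fun measurable_fst measurable_snd
  have h0 : (μ.prod μ) {p : ℝ × ℝ | p.1 = p.2} = 0 := by
    rw [Measure.measure_prod_null hD]
    refine Filter.Eventually.of_forall fun x => ?_
    have : Prod.mk x ⁻¹' {p : ℝ × ℝ | p.1 = p.2} = {x} := by
      ext y
      simp [eq_comm]
    simp only [this, measure_singleton, Pi.zero_apply]
  rw [← hind, Measure.map_apply ((measurable_pi_apply a).prodMk (measurable_pi_apply b)) hD] at h0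
  exact h0

/-- Among independent identically distributed variables without atoms each one is the smallest
with probability at most `1 / C.card`, by symmetry. -/
theorem pi_min_le [NullSingletonClass μ] [DecidableEq ι] {C : Finset ι} {k : ι} (hk : k ∈ C) :
    Measure.pi (fun _ : ι => μ) {x | ∀ j ∈ C, x k ≤ x j} ≤ (C.card : ENNReal)⁻¹ := by
  set P := Measure.pi fun _ : ι => μ with hP
  let W : ι → Set (ι → ℝ) := fun k => {x | ∀ j ∈ C, x k ≤ x j}
  have hsymm : ∀ a ∈ C, P (W a) = P (W k) := by
    intro a ha
    have hmp := measurePreserving_piCongrLeft (fun _ : ι => μ) (Equiv.swap a k)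
    have happ : ∀ (x : ι → ℝ) (i : ι),
        MeasurableEquiv.piCongrLeft (fun _ : ι => ℝ) (Equiv.swap a k) x i =
          x (Equiv.swap a k i) := by
      intro x i
      have := MeasurableEquiv.piCongrLeft_apply_apply (β := fun _ : ι => ℝ) (Equiv.swap a k) x
        (Equiv.swap a k i)
      simpa using this
    rw [← hmp.measure_preimage (measurableSet_forall_mem_le C a).nullMeasurableSet]
    congr 1
    ext x
    simp only [W, Set.mem_preimage, Set.mem_ofPred_eq, happ, Equiv.swap_apply_left]
    have hmem : ∀ j ∈ C, Equiv.swap a k j ∈ C := by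
      intro j hj
      by_cases h1 : j = a
      · rwa [h1, Equiv.swap_apply_left]
      by_cases h2 : j = k
      · rwa [h2, Equiv.swap_apply_right]
      rwa [Equiv.swap_apply_of_ne_of_ne h1 h2]
    refine ⟨fun h j hj => ?_, fun h j hj => h _ (hmem j hj)⟩
    simpa using h _ (hmem j hj)
  have hdisj : (C : Set ι).Pairwise (Function.onFun (AEDisjoint P) W) := by
    intro a ha b hb hab
    refine measure_mono_null ?_ (pi_eval_eq_eval_null μ hab)
    rintro x ⟨h1, h2⟩
    exact le_antisymm (h1 b hb) (h2 a ha)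
  have hsum := measure_biUnion_finset₀ hdisj fun a _ =>
    (measurableSet_forall_mem_le C a).nullMeasurableSet
  rw [Finset.sum_congr rfl hsymm, Finset.sum_const, nsmul_eq_mul] at hsum
  have h1 : (C.card : ENNReal) * P (W k) ≤ 1 := hsum ▸ prob_le_one
  rw [mul_comm] at h1
  exact ENNReal.le_inv_iff_mul_le.2 h1

/-- Bernoulli's inequality for the square root gives `1 / 4 ≤ (1 - 1 / q) ^ q`. -/
theorem one_quarter_le_pow {q : ℕ} (hq : 2 ≤ q) : (1 / 4 : ℝ) ≤ (1 - (q : ℝ)⁻¹) ^ q := by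
  have hq' : (2 : ℝ) ≤ q := by exact_mod_cast hq
  have hinv : (q : ℝ)⁻¹ ≤ 2⁻¹ := inv_anti₀ two_pos hq'
  have h0 : (0 : ℝ) ≤ 1 + -(q : ℝ)⁻¹ := by linarith
  have h1 := one_add_mul_self_le_rpow_one_add (s := -(q : ℝ)⁻¹) (by linarith)
    (p := (q : ℝ) / 2) (by linarith)
  have h2 : 1 + (q : ℝ) / 2 * -(q : ℝ)⁻¹ = 1 / 2 := by
    field_simp
    norm_num
  rw [h2] at h1
  have h3 : ((1 + -(q : ℝ)⁻¹) ^ ((q : ℝ) / 2)) ^ 2 = (1 - (q : ℝ)⁻¹) ^ q := by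
    rw [← Real.rpow_natCast, ← Real.rpow_mul h0, ← Real.rpow_natCast]
    congr 1
    push_cast
    ring
  rw [← h3]
  nlinarith

/-- If each of `q` independent rows picks its smallest entry in a set `C` of `q` columns, then a
given column of `C` is never picked with probability at least `1 / 4`. -/
theorem one_quarter_le_pi_not_min [NullSingletonClass μ] {n q : ℕ} (hq : 2 ≤ q)
    {D C : Finset (Fin n)} (hD : D.card = q) (hC : C.card = q) {j : Fin n} (hj : j ∈ C) :
    1 / 4 ≤ (Measure.pi fun _ : Fin n × Fin n => μ).real
      {ν | ∀ i ∈ D, ∃ k ∈ C, ν (i, k) < ν (i, j)} := by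
  have hcurry := Measure.infinitePi_map_curry (X := ℝ) (fun _ _ : Fin n => μ)
  simp only [Measure.infinitePi_eq_pi] at hcurry
  let W : Set (Fin n → ℝ) := {x | ∀ k ∈ C, x j ≤ x k}
  have hW : MeasurableSet W := measurableSet_forall_mem_le C j
  let E : Set (Fin n → Fin n → ℝ) := Set.univ.pi fun i => if i ∈ D then Wᶜ else Set.univ
  have hpre : {ν : Fin n × Fin n → ℝ | ∀ i ∈ D, ∃ k ∈ C, ν (i, k) < ν (i, j)} =
      MeasurableEquiv.curry (Fin n) (Fin n) ℝ ⁻¹' E := by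
    ext ν
    simp only [E, W, Set.mem_preimage, Set.mem_pi, Set.mem_univ, true_implies, Set.mem_ofPred_eq,
      MeasurableEquiv.coe_curry]
    refine forall_congr' fun i => ?_
    by_cases hi : i ∈ D <;> simp [hi, Function.curry]
  have hrow : (Measure.pi fun _ : Fin n => μ).real Wᶜ ≥ 1 - (q : ℝ)⁻¹ := by
    rw [probReal_compl_eq_one_sub hW]
    have h := ENNReal.toReal_mono (by simp [hC]; omega) (pi_min_le μ hj)
    rw [hC, ENNReal.toReal_inv, ENNReal.toReal_natCast] at h
    exact sub_le_sub_left h 1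
  have hval : (Measure.pi fun _ : Fin n × Fin n => μ).real
      {ν | ∀ i ∈ D, ∃ k ∈ C, ν (i, k) < ν (i, j)} =
        (Measure.pi fun _ : Fin n => μ).real Wᶜ ^ q := by
    rw [measureReal_def, hpre, ← MeasurableEquiv.map_apply, hcurry, Measure.pi_pi,
      ENNReal.toReal_prod, ← hD, ← Finset.prod_const, ← Finset.prod_subset (Finset.subset_univ D)]
    · exact Finset.prod_congr rfl fun i hi => by rw [if_pos hi, measureReal_def]
    · intro i _ hi
      rw [if_neg hi]
      simp
  rw [hval]
  have hinv : (q : ℝ)⁻¹ ≤ 1 := inv_le_one_of_one_le₀ (by exact_mod_cast (by omega : 1 ≤ q))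
  exact (one_quarter_le_pow hq).trans (pow_le_pow_left₀ (by linarith) hrow q)

end Noise

section NoiseLaw

variable {ξ : ℝ}

theorem isProbabilityMeasure_cond_Ioo (hξ : 0 < ξ) :
    IsProbabilityMeasure (ProbabilityTheory.cond volume (Set.Ioo 0 ξ) : Measure ℝ) :=
  ProbabilityTheory.cond_isProbabilityMeasure_of_finite (by simp [hξ]) (by simp)

theorem nullSingletonClass_cond_Ioo :
    NullSingletonClass (ProbabilityTheory.cond volume (Set.Ioo 0 ξ) : Measure ℝ) :=
  ⟨fun x => ProbabilityTheory.cond_absolutelyContinuous (measure_singleton x)⟩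

theorem isProbabilityMeasure_noiseLaw (n d : ℕ) (hξ : 0 < ξ) :
    IsProbabilityMeasure (noiseLaw n d ξ) := by
  have := isProbabilityMeasure_cond_Ioo hξ
  unfold noiseLaw
  infer_instance

theorem ae_noiseLaw_mem (n d : ℕ) (hξ : 0 < ξ) : ∀ᵐ ν ∂noiseLaw n d ξ, ∀ p, ν p ∈ Set.Ioo 0 ξ := by
  have := isProbabilityMeasure_cond_Ioo hξ
  exact ae_all_iff.2 fun p => Measure.tendsto_eval_ae_ae.eventually
    (ProbabilityTheory.ae_cond_mem measurableSet_Ioo)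

end NoiseLaw

theorem measurable_expectedGain {n d : ℕ} (s lam : ℝ) (A : Policy n d) :
    Measurable fun S => expectedGain (thresholdModel s lam) A S := by
  have hS : ∀ i j, Measurable fun S : Similarity n d => S i j := fun i j =>
    (measurable_pi_apply j).comp (measurable_pi_apply i)
  have hbid : ∀ k i j, Measurable fun S : Similarity n d =>
      (thresholdModel s lam).bidProb k (S i j) := by
    intro k i j
    simp only [thresholdModel]
    exact Measurable.ite ((MeasurableSet.const _).inter
      (measurableSet_lt measurable_const (hS i j))) measurable_const measurable_const
  unfold expectedGain
  refine Finset.measurable_sum _ fun ω _ => Measurable.mul ?_ ?_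
  · refine Finset.measurable_prod _ fun i _ => (A.measurable_prob _ _ _).mul ?_
    refine Finset.measurable_prod _ fun j _ => ?_
    split_ifs
    · exact hbid _ i j
    · exact (hbid _ i j).const_sub 1
  · simp only [totalGain, thresholdModel]
    refine measurable_const.add (measurable_const.mul ?_)
    refine Finset.measurable_sum _ fun i _ => Finset.measurable_sum _ fun j _ => ?_
    exact (((hS i j).const_pow 2).sub_const 1).div_const _

theorem measurable_noisySimilarity {n d : ℕ} (s : ℝ) (S' : Matrix (Fin n) (Fin d) ℝ) :
    Measurable fun ν => noisySimilarity s S' ν := by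
  refine measurable_pi_lambda _ fun i => measurable_pi_lambda _ fun j => ?_
  unfold noisySimilarity
  split_ifs
  · exact measurable_const.sub (measurable_pi_apply _)
  · exact measurable_pi_apply _

theorem IsCommunity.bestValue_le {n m q : ℕ} {s ξ : ℝ} {rc pc : Fin n → Fin m}
    {S : Similarity n n} (hC : IsCommunity q s ξ rc pc S) (i : Fin n) : bestValue (S i) ≤ n := by
  obtain ⟨π, hπ⟩ := exists_reviewerValue_eq_bestValue (S i)
  rw [← hπ, reviewerValue]
  calc _ ≤ ∑ j : Fin n, (1 : ℝ) := by
        refine Finset.sum_le_sum fun j _ => ?_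
        have h1 := one_le_logb_two_add_one (k := position π j) (by simp [position])
        rw [div_le_one (by linarith)]
        have : (2 : ℝ) ^ S i j ≤ 2 := by
          simpa using Real.rpow_le_rpow_of_exponent_le (x := (2 : ℝ)) (by norm_num)
            (hC.mem_Icc i j).2
        linarith
    _ = n := by simp

theorem IsCommunity.totalGain_nonneg {n m q : ℕ} {s ξ lam : ℝ} {rc pc : Fin n → Fin m}
    {S : Similarity n n} (hC : IsCommunity q s ξ rc pc S) (hlam : 0 ≤ lam)
    (ω : Fin n → Round n) : 0 ≤ totalGain (thresholdModel s lam) S ω := by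
  rw [totalGain_thresholdModel]
  refine add_nonneg (Finset.sum_nonneg fun j _ => Real.sqrt_nonneg _)
    (mul_nonneg hlam (Finset.sum_nonneg fun i _ => Finset.sum_nonneg fun j _ => div_nonneg ?_ ?_))
  · exact sub_nonneg.2 (Real.one_le_rpow (by norm_num) (hC.mem_Icc i j).1)
  · linarith [one_le_logb_two_add_one (k := position (ω i).1 j) (by simp [position])]

/-! ### The noisy community model -/

theorem card_divNat_eq (m q : ℕ) (c : Fin m) :
    (univ.filter fun k : Fin (m * q) => k.divNat = c).card = q := by
  have : (univ.filter fun k : Fin (m * q) => k.divNat = c) =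
      univ.map ⟨fun t : Fin q => finProdFinEquiv (c, t), fun a b h => by simpa using h⟩ := by
    ext k
    simp only [mem_filter, mem_univ, true_and, mem_map]
    constructor
    · rintro rfl
      exact ⟨k.modNat, finProdFinEquiv.apply_symm_apply k⟩
    · rintro ⟨t, rfl⟩
      exact congrArg Prod.fst (finProdFinEquiv.symm_apply_apply (c, t))
  rw [this, card_map, card_univ, Fintype.card_fin]

theorem card_filter_comp_equiv {α : Type*} [Fintype α] (e : Equiv.Perm α) (p : α → Prop)
    [DecidablePred p] : (univ.filter fun a => p (e a)).card = (univ.filter p).card :=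
  Finset.card_bij (fun a _ => e a) (fun a ha => by simpa using ha)
    (fun a _ b _ h => e.injective h) fun b hb => ⟨e.symm b, by simpa using hb, by simp⟩

theorem IsNoiselessCommunity.exists_communities {m q : ℕ} {s : ℝ}
    {S' : Matrix (Fin (m * q)) (Fin (m * q)) ℝ} (h : IsNoiselessCommunity m q s S') :
    ∃ rc pc : Fin (m * q) → Fin m,
      (∀ c, (univ.filter fun i => rc i = c).card = q) ∧
      (∀ c, (univ.filter fun j => pc j = c).card = q) ∧
      ∀ i j, S' i j = if rc i = pc j then s else 0 := by
  obtain ⟨-, σ, τ, rfl⟩ := h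
  refine ⟨fun i => (σ i).divNat, fun j => (τ.symm j).divNat, fun c => ?_, fun c => ?_, ?_⟩
  · rw [card_filter_comp_equiv σ fun i => i.divNat = c, card_divNat_eq]
  · rw [card_filter_comp_equiv τ.symm fun i => i.divNat = c, card_divNat_eq]
  · intro i j
    rw [Equiv.Perm.permMatrix, Equiv.Perm.permMatrix, PEquiv.mul_toMatrix_toPEquiv,
      PEquiv.toMatrix_toPEquiv_mul]
    simp [blockMatrix]

theorem isCommunity_noisySimilarity {n m q : ℕ} {s ξ : ℝ} {rc pc : Fin n → Fin m}
    {S' : Matrix (Fin n) (Fin n) ℝ} {ν : Fin n × Fin n → ℝ} (hs : s ∈ Set.Icc (0.01 : ℝ) 1)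
    (hrc : ∀ c, (univ.filter fun i => rc i = c).card = q)
    (hpc : ∀ c, (univ.filter fun j => pc j = c).card = q)
    (hS' : ∀ i j, S' i j = if rc i = pc j then s else 0) (hξ : 0 < ξ) (hξ' : ξ ≤ 1 / 1000)
    (hν : ∀ p, ν p ∈ Set.Ioo 0 ξ) : IsCommunity q s ξ rc pc (noisySimilarity s S' ν) where
  card_reviewers := hrc
  card_papers := hpc
  high i j h := by
    have := hν (i, j)
    simp only [noisySimilarity, hS', h, if_true]
    exact ⟨by linarith [this.2], by linarith [this.1]⟩
  low i j h := by
    have h0 : (0 : ℝ) ≠ s := by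
      have := hs.1
      norm_num at this
      intro h
      linarith
    simp only [noisySimilarity, hS', h, if_false, h0]
    exact hν (i, j)
  le_level := hs.1
  level_le := hs.2
  noise_pos := hξ
  noise_le := hξ'

/-! ### Numerical estimates -/

theorem exp_neg_four_exp_one_le : Real.exp (-(Real.exp 1 * 4)) ≤ 22 / 1000000 := by
  have he := Real.exp_one_gt_d9
  have h1 : Real.exp 10.873 ≤ Real.exp (Real.exp 1 * 4) := Real.exp_le_exp.2 (by linarith)
  have h2 : Real.exp 10.873 = Real.exp 1 ^ 10 * Real.exp 0.873 := by
    rw [← Real.exp_nat_mul, ← Real.exp_add]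
    norm_num
  have h3 : (2.7 : ℝ) ^ 10 ≤ Real.exp 1 ^ 10 := pow_le_pow_left₀ (by norm_num) (by linarith) 10
  have h4 := Real.quadratic_le_exp_of_nonneg (x := 0.873) (by norm_num)
  have h5 : (1000000 / 22 : ℝ) ≤ Real.exp (Real.exp 1 * 4) := by
    rw [h2] at h1
    refine le_trans ?_ h1
    refine le_trans ?_ (mul_le_mul h3 h4 (by norm_num) (by positivity))
    norm_num
  rw [Real.exp_neg]
  calc (Real.exp (Real.exp 1 * 4))⁻¹ ≤ (1000000 / 22 : ℝ)⁻¹ := inv_anti₀ (by norm_num) h5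
    _ = _ := by norm_num

/-- If `u` is at most `u₀` times `1 + y + y ^ 2`, where `y = x - 4`, then `u * exp (-(exp 1 * x))`
is at most the value of this bound at `x = 4`, since `1 + y + y ^ 2 ≤ exp (2 * y)`. -/
theorem mul_exp_neg_le {u₀ u x : ℝ} (hx : 4 ≤ x) (hu₀ : 0 ≤ u₀)
    (hu : u ≤ u₀ * (1 + (x - 4) + (x - 4) ^ 2)) :
    u * Real.exp (-(Real.exp 1 * x)) ≤ u₀ * (22 / 1000000) := by
  have he := Real.exp_one_gt_d9
  have hy : 0 ≤ x - 4 := by linarith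
  have h1 : 1 + (x - 4) + (x - 4) ^ 2 ≤ Real.exp (Real.exp 1 * (x - 4)) := by
    have h2 := Real.quadratic_le_exp_of_nonneg (x := 2 * (x - 4)) (by linarith)
    have h3 : Real.exp (2 * (x - 4)) ≤ Real.exp (Real.exp 1 * (x - 4)) :=
      Real.exp_le_exp.2 (mul_le_mul_of_nonneg_right (by linarith) hy)
    nlinarith
  have h4 : Real.exp (Real.exp 1 * (x - 4)) * Real.exp (-(Real.exp 1 * x)) =
      Real.exp (-(Real.exp 1 * 4)) := by
    rw [← Real.exp_add]
    ring_nf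
  calc u * Real.exp (-(Real.exp 1 * x))
      ≤ u₀ * Real.exp (Real.exp 1 * (x - 4)) * Real.exp (-(Real.exp 1 * x)) :=
        mul_le_mul_of_nonneg_right (hu.trans (mul_le_mul_of_nonneg_left h1 hu₀))
          (Real.exp_pos _).le
    _ = u₀ * Real.exp (-(Real.exp 1 * 4)) := by rw [mul_assoc, h4]
    _ ≤ _ := mul_le_mul_of_nonneg_left exp_neg_four_exp_one_le hu₀

theorem noise_le_exp {lam ξ x : ℝ} (hlam : 0 ≤ lam)
    (h : ξ ≤ (1 + lam)⁻¹ * Real.exp (-(Real.exp 1 * x))) :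
    ξ + lam * ξ ≤ Real.exp (-(Real.exp 1 * x)) := by
  rw [inv_mul_eq_div, le_div_iff₀ (by linarith)] at h
  linarith

theorem natCast_mul_swapCost {n : ℕ} (hn : n ≠ 0) (ξ : ℝ) :
    n * swapCost n ξ = 7 / 5 * ((n - 1) * ξ) := by
  have : (n : ℝ) ≠ 0 := Nat.cast_ne_zero.2 hn
  rw [swapCost]
  field_simp

theorem mul_natCast_mul_swapCost_le {n : ℕ} {lam ξ : ℝ} (hn : 4 ≤ n) (hlam : 0 ≤ lam) (hξ : 0 < ξ)
    (h : ξ ≤ (1 + lam)⁻¹ * Real.exp (-(Real.exp 1 * n))) :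
    lam * (n * swapCost n ξ) ≤ 0.0001 := by
  have hn' : (4 : ℝ) ≤ n := by exact_mod_cast hn
  have h1 := noise_le_exp hlam h
  have h2 := mul_exp_neg_le (u := n - 1) (u₀ := 3) hn' (by norm_num) (by nlinarith)
  have h3 : ((n : ℝ) - 1) * (lam * ξ) ≤ (n - 1) * Real.exp (-(Real.exp 1 * n)) :=
    mul_le_mul_of_nonneg_left (by linarith) (by linarith)
  rw [natCast_mul_swapCost (by omega)]
  linarith

theorem two_mul_logb_two_le {x : ℝ} (hx : 4 ≤ x) : 2 * Real.logb 2 x ≤ x := by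
  have h2 := Real.log_two_gt_d9
  have h1 : Real.log x ≤ 2 * Real.log 2 + (x / 4 - 1) := by
    have : Real.log x = Real.log 4 + Real.log (x / 4) := by
      rw [← Real.log_mul (by norm_num) (by positivity)]
      congr 1
      ring
    rw [this, show (4 : ℝ) = 2 ^ 2 by norm_num, Real.log_pow]
    have := Real.log_le_sub_one_of_pos (show 0 < x / 2 ^ 2 by positivity)
    push_cast
    linarith
  rw [Real.logb, ← mul_div_assoc, div_le_iff₀ (by linarith)]
  nlinarith

/-- The lower bound for the loss of BID at a single reviewer. The constant is `0.00688 / 4`: the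
first factor bounds `2 ^ (s - ξ) - 2 ^ ξ` for `s = 0.01`, and `log₂ (5 / 4) ≥ 1 / 4` bounds the
difference of the logarithms. -/
theorem le_displacementLoss {n q B : ℕ} {s ξ : ℝ} (hs : 0.01 ≤ s) (hξ : ξ ≤ 22 / 1000000)
    (hq : 1 ≤ q) (hqB : q + 1 ≤ 4 * B) (hn : q + B + 1 ≤ n) :
    172 / 100000 / Real.logb 2 n ^ 2 ≤ displacementLoss q B s ξ := by
  have hq' : (1 : ℝ) ≤ q := by exact_mod_cast hq
  have hqB' : (q : ℝ) + 1 ≤ 4 * B := by exact_mod_cast hqB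
  have hn' : (q : ℝ) + B + 1 ≤ n := by exact_mod_cast hn
  have hl2 := Real.log_two_gt_d9
  have hl2' := Real.log_two_lt_d9
  set a := Real.logb 2 ((q : ℝ) + 1) with ha
  set b := Real.logb 2 ((q : ℝ) + B + 1) with hb
  set l := Real.logb 2 (n : ℝ) with hl
  have ha1 : 1 ≤ a := one_le_logb_two_add_one hq'
  have hab : 1 / 4 ≤ b - a := by
    rw [hb, ha, ← Real.logb_div (by linarith) (by linarith), Real.logb,
      le_div_iff₀ (by linarith)]
    have h1 : (5 / 4 : ℝ) ≤ (q + B + 1) / (q + 1) := by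
      rw [le_div_iff₀ (by linarith)]
      linarith
    have h2 := Real.log_le_log (by norm_num) h1
    have h3 := Real.one_sub_inv_le_log_of_pos (show (0 : ℝ) < 5 / 4 by norm_num)
    norm_num at h3
    linarith
  have hbl : b ≤ l := Real.logb_le_logb_of_le (by norm_num) (by linarith) hn'
  have hmain : 1 / 4 / l ^ 2 ≤ 1 / a - 1 / b := by
    have h0 : 0 < a := by linarith
    have h0' : 0 < b := by linarith
    rw [div_sub_div _ _ h0.ne' h0'.ne']
    refine div_le_div₀ (by linarith) (by linarith) (by positivity) ?_
    nlinarith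
  -- `0.009956` is `0.01` minus twice the bound for the noise
  have hgap : 688 / 100000 ≤ (2 : ℝ) ^ (s - ξ) - 2 ^ ξ := by
    have h1 : (2 : ℝ) ^ (9956 / 1000000 + ξ) ≤ 2 ^ (s - ξ) :=
      Real.rpow_le_rpow_of_exponent_le (by norm_num) (by linarith)
    rcases le_or_gt 0 ξ with h0 | h0
    · have h2 : (1 : ℝ) ≤ 2 ^ ξ := Real.one_le_rpow (by norm_num) h0
      have h3 := Real.add_one_le_exp (Real.log 2 * (9956 / 1000000))
      rw [← Real.rpow_def_of_pos two_pos] at h3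
      rw [Real.rpow_add two_pos] at h1
      nlinarith
    · have h2 : (2 : ℝ) ^ ξ ≤ 1 := Real.rpow_le_one_of_one_le_of_nonpos (by norm_num) h0.le
      have h3 := Real.add_one_le_exp (Real.log 2 * (9956 / 1000000))
      rw [← Real.rpow_def_of_pos two_pos] at h3
      have h4 : (2 : ℝ) ^ (9956 / 1000000 : ℝ) ≤ 2 ^ (s - ξ) :=
        Real.rpow_le_rpow_of_exponent_le (by norm_num) (by norm_num at hs ⊢; linarith)
      linarith
  have hpos : 0 ≤ 1 / 4 / l ^ 2 := by positivity
  calc 172 / 100000 / l ^ 2 = 688 / 100000 * (1 / 4 / l ^ 2) := by ring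
    _ ≤ displacementLoss q B s ξ := mul_le_mul hgap hmain hpos (by linarith)

/-- The loss of BID, over the `K` reviewers at which it occurs, outweighs the exchange costs of
SUPER*. -/
theorem le_displacementLoss_sub_swapCost {n q B K : ℕ} {s ξ : ℝ} (hs : 0.01 ≤ s) (hξ : 0 < ξ)
    (hξ' : ξ ≤ Real.exp (-(Real.exp 1 * n))) (hn4 : 4 ≤ n) (hq : 1 ≤ q) (hqB : q + 1 ≤ 4 * B)
    (hn : q + B + 1 ≤ n) (hK : n ≤ 8 * K) :
    5 / 100000 * n / Real.logb 2 n ^ 2 ≤ K * displacementLoss q B s ξ - n * swapCost n ξ := by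
  have hn' : (4 : ℝ) ≤ n := by exact_mod_cast hn4
  have hK' : (n : ℝ) ≤ 8 * K := by exact_mod_cast hK
  set l := Real.logb 2 (n : ℝ) with hl
  have hl1 : 1 ≤ l := by
    rw [hl, Real.le_logb_iff_rpow_le (by norm_num) (by linarith)]
    norm_num
    linarith
  have hln : 2 * l ≤ n := two_mul_logb_two_le hn'
  have h1 := mul_exp_neg_le (u := 1) (u₀ := 1) hn' (by norm_num) (by nlinarith)
  have h2 := mul_exp_neg_le (u := (n : ℝ) ^ 2) (u₀ := 16) hn' (by norm_num) (by nlinarith)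
  have h3 := le_displacementLoss (ξ := ξ) hs (by linarith) hq hqB hn
  rw [← hl] at h3
  have hl2 : 0 < l ^ 2 := by positivity
  have h4 : ξ ≤ 88 / 1000000 / l ^ 2 := by
    rw [le_div_iff₀ hl2]
    have h5 : l ^ 2 ≤ (n : ℝ) ^ 2 / 4 := by nlinarith
    calc ξ * l ^ 2 ≤ Real.exp (-(Real.exp 1 * n)) * ((n : ℝ) ^ 2 / 4) :=
          mul_le_mul hξ' h5 hl2.le (Real.exp_pos _).le
      _ ≤ 88 / 1000000 := by linarith
  have h5 : (n : ℝ) / 8 * (172 / 100000 / l ^ 2) ≤ K * displacementLoss q B s ξ :=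
    mul_le_mul (by linarith) h3 (by positivity) (by linarith)
  have h6 : ((n : ℝ) - 1) * ξ ≤ n * (88 / 1000000 / l ^ 2) :=
    mul_le_mul (by linarith) h4 hξ.le (by linarith)
  rw [natCast_mul_swapCost (by omega)]
  have h7 : 5 / 100000 * n / l ^ 2 ≤
      (n : ℝ) / 8 * (172 / 100000 / l ^ 2) - 7 / 5 * (n * (88 / 1000000 / l ^ 2)) := by
    have : 0 ≤ (n : ℝ) / l ^ 2 := by positivity
    have e1 : 5 / 100000 * n / l ^ 2 = 5 / 100000 * ((n : ℝ) / l ^ 2) := by ring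
    have e2 : (n : ℝ) / 8 * (172 / 100000 / l ^ 2) - 7 / 5 * (n * (88 / 1000000 / l ^ 2)) =
      (215 / 1000000 - 1232 / 10000000) * ((n : ℝ) / l ^ 2) := by ring
    rw [e1, e2]
    nlinarith
  linarith

/-! ### Averaging over the noise -/

section Averaging

variable {n m q : ℕ} {s ξ lam : ℝ} {rc pc : Fin n → Fin m} {S' : Matrix (Fin n) (Fin n) ℝ}

theorem integrable_expectedGain (hξ : 0 < ξ) (hlam : 0 ≤ lam)
    (hC : ∀ ν, (∀ p, ν p ∈ Set.Ioo 0 ξ) → IsCommunity q s ξ rc pc (noisySimilarity s S' ν))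
    (A : Policy n n) :
    Integrable (fun ν => expectedGain (thresholdModel s lam) A (noisySimilarity s S' ν))
      (noiseLaw n n ξ) := by
  have := isProbabilityMeasure_noiseLaw n n hξ
  have hM := thresholdModel_bidProb_mem s lam
  refine Integrable.of_bound ((measurable_expectedGain s lam A).comp
    (measurable_noisySimilarity s S')).aestronglyMeasurable (n + lam * ∑ _i : Fin n, (n : ℝ)) ?_
  filter_upwards [ae_noiseLaw_mem n n hξ] with ν hν
  have hCν := hC ν hν
  rw [Real.norm_of_nonneg (le_expectedGain hM fun ω _ => hCν.totalGain_nonneg hlam ω)]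
  refine expectedGain_le hM fun ω hω => (hCν.totalGain_le hlam hω).trans ?_
  have := mul_le_mul_of_nonneg_left
    (Finset.sum_le_sum fun i (_ : i ∈ univ) => hCν.bestValue_le i) hlam
  linarith

/-- Integrating a comparison of two policies that holds for each noise matrix. -/
theorem integral_le_noisyExpectedGain_sub (hξ : 0 < ξ) (hlam : 0 ≤ lam)
    (hC : ∀ ν, (∀ p, ν p ∈ Set.Ioo 0 ξ) → IsCommunity q s ξ rc pc (noisySimilarity s S' ν))
    {A B : Policy n n} {f : (Fin n × Fin n → ℝ) → ℝ} (hf : Integrable f (noiseLaw n n ξ))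
    (h : ∀ ν, (∀ p, ν p ∈ Set.Ioo 0 ξ) →
      f ν ≤ expectedGain (thresholdModel s lam) A (noisySimilarity s S' ν) -
        expectedGain (thresholdModel s lam) B (noisySimilarity s S' ν)) :
    ∫ ν, f ν ∂noiseLaw n n ξ ≤ noisyExpectedGain (thresholdModel s lam) A s ξ S' -
      noisyExpectedGain (thresholdModel s lam) B s ξ S' := by
  have hA := integrable_expectedGain hξ hlam hC A
  have hB := integrable_expectedGain hξ hlam hC B
  rw [noisyExpectedGain, noisyExpectedGain, ← integral_sub hA hB]
  refine integral_mono_ae hf (hA.sub hB) ?_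
  filter_upwards [ae_noiseLaw_mem n n hξ] with ν hν
  exact h ν hν

theorem const_le_noisyExpectedGain_sub (hξ : 0 < ξ) (hlam : 0 ≤ lam)
    (hC : ∀ ν, (∀ p, ν p ∈ Set.Ioo 0 ξ) → IsCommunity q s ξ rc pc (noisySimilarity s S' ν))
    {A B : Policy n n} {c : ℝ}
    (h : ∀ ν, (∀ p, ν p ∈ Set.Ioo 0 ξ) →
      c ≤ expectedGain (thresholdModel s lam) A (noisySimilarity s S' ν) -
        expectedGain (thresholdModel s lam) B (noisySimilarity s S' ν)) :
    c ≤ noisyExpectedGain (thresholdModel s lam) A s ξ S' -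
      noisyExpectedGain (thresholdModel s lam) B s ξ S' := by
  have := isProbabilityMeasure_noiseLaw n n hξ
  simpa using integral_le_noisyExpectedGain_sub hξ hlam hC (integrable_const c) h

/-- Papers for which each member of the community has a better one, in terms of the noise. -/
def dominatedSet (rc pc : Fin n → Fin m) (j : Fin n) : Set (Fin n × Fin n → ℝ) :=
  {ν | ∀ i ∈ univ.filter fun i => rc i = pc j, ∃ k ∈ univ.filter fun k => pc k = pc j,
    ν (i, k) < ν (i, j)}

theorem measurableSet_dominatedSet (j : Fin n) : MeasurableSet (dominatedSet rc pc j) := by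
  have : dominatedSet rc pc j = ⋂ i ∈ univ.filter fun i => rc i = pc j,
      ⋃ k ∈ univ.filter fun k => pc k = pc j, {ν | ν (i, k) < ν (i, j)} := by
    ext ν
    simp [dominatedSet]
  rw [this]
  exact Finset.measurableSet_biInter _ fun i _ => Finset.measurableSet_biUnion _ fun k _ =>
    measurableSet_lt (measurable_pi_apply _) (measurable_pi_apply _)

theorem isDominated_of_mem_dominatedSet (hS' : ∀ i j, S' i j = if rc i = pc j then s else 0)
    {ν : Fin n × Fin n → ℝ} {j : Fin n} (h : ν ∈ dominatedSet rc pc j) :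
    IsDominated rc pc (noisySimilarity s S' ν) j := by
  intro i hi
  obtain ⟨k, hk, hlt⟩ := h i (by simp [hi])
  have hk : pc k = pc j := by simpa using hk
  refine ⟨k, hk, ?_⟩
  simp only [noisySimilarity, hS', hi, hk, if_true]
  linarith

/-- On average SIM leaves at least a quarter of the papers without a bid. -/
theorem le_integral_sum_dominatedSet (hξ : 0 < ξ) (hq : 2 ≤ q)
    (hrc : ∀ c, (univ.filter fun i => rc i = c).card = q)
    (hpc : ∀ c, (univ.filter fun j => pc j = c).card = q) :
    (n : ℝ) / 4 ≤
      ∫ ν, ∑ j, (dominatedSet rc pc j).indicator (fun _ => (1 : ℝ)) ν ∂noiseLaw n n ξ := by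
  have := isProbabilityMeasure_noiseLaw n n hξ
  have := isProbabilityMeasure_cond_Ioo hξ
  have := nullSingletonClass_cond_Ioo (ξ := ξ)
  rw [integral_finsetSum _ fun j _ =>
    (integrable_const (1 : ℝ)).indicator (measurableSet_dominatedSet j)]
  calc (n : ℝ) / 4 = ∑ _j : Fin n, (1 / 4 : ℝ) := by
        simp
        ring
    _ ≤ _ := by
        refine Finset.sum_le_sum fun j _ => ?_
        rw [integral_indicator_const _ (measurableSet_dominatedSet j), smul_eq_mul, mul_one]
        exact one_quarter_le_pi_not_min _ hq (hrc _) (hpc _) (by simp)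

end Averaging

section Comparison

variable {n m q : ℕ} {s ξ lam : ℝ} {rc pc : Fin n → Fin m} {S : Similarity n n}

theorem IsCommunity.le_expectedGain_superStar (hC : IsCommunity q s ξ rc pc S) (hlam : 0 ≤ lam)
    (hn : 1 ≤ n) (hcost : lam * (n * swapCost n ξ) ≤ 0.0001) {A : Policy n n}
    (hA : IsSuperStar (thresholdModel s lam) (zeroHeuristic n n) A) :
    n + lam * ∑ i, bestValue (S i) - lam * (n * swapCost n ξ) ≤
      expectedGain (thresholdModel s lam) A S := by
  refine le_expectedGain (thresholdModel_bidProb_mem s lam) fun ω hω =>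
    hC.le_totalGain_superStar hlam ?_ hA hω
  have hn' : (1 : ℝ) ≤ n := by exact_mod_cast hn
  have h0 : 0 ≤ lam * swapCost n ξ := by
    have h1 : 1 / (n : ℝ) ≤ 1 := by
      rw [div_le_one (by linarith)]
      exact hn'
    have := hC.noise_pos
    rw [swapCost]
    exact mul_nonneg hlam (mul_nonneg (by positivity) (by linarith))
  norm_num at hcost
  nlinarith

theorem IsCommunity.expectedGain_le (hC : IsCommunity q s ξ rc pc S) (hlam : 0 ≤ lam)
    (A : Policy n n) :
    expectedGain (thresholdModel s lam) A S ≤ n + lam * ∑ i, bestValue (S i) :=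
  PaperBidding.expectedGain_le (thresholdModel_bidProb_mem s lam) fun _ hω =>
    hC.totalGain_le hlam hω

theorem IsCommunity.expectedGain_simPolicy_le (hC : IsCommunity q s ξ rc pc S) (hlam : 0 ≤ lam)
    {D : Fin n → Prop} [DecidablePred D] (hD : ∀ j, D j → IsDominated rc pc S j) :
    expectedGain (thresholdModel s lam) (simPolicy n n) S ≤ n + lam * ∑ i, bestValue (S i) -
      1 / 2 * ∑ j, if D j then 1 else 0 := by
  classical
  refine PaperBidding.expectedGain_le (thresholdModel_bidProb_mem s lam) fun ω hω =>
    (hC.totalGain_simPolicy_le hlam hω).trans ?_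
  have : (∑ j, if D j then (1 : ℝ) else 0) ≤ ∑ j, if IsDominated rc pc S j then 1 else 0 := by
    refine Finset.sum_le_sum fun j _ => ?_
    by_cases h : D j
    · simp [h, hD j h]
    · rw [if_neg h]
      split_ifs <;> norm_num
  linarith

end Comparison

/-- The parameters for BID. Among the first `L + 1` reviewers at least `L + 1 - m` are not first in
their community, and they find at least `m * q + 1 - q - L` fresh papers of other communities. The
sum of these two numbers is `(m - 1) * (q - 1) + 1`, and `L` is chosen such that each of them is
about half of it. -/
theorem exists_displacement_parameters {m q : ℕ} (hm : 2 ≤ m) (hq : 2 ≤ q) :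
    ∃ B L K : ℕ, 1 ≤ B ∧ L < m * q ∧ q + L + B ≤ m * q + 1 ∧ m + K ≤ L + 1 ∧
      q + 1 ≤ 4 * B ∧ q + B + 1 ≤ m * q ∧ m * q ≤ 8 * K := by
  obtain ⟨a, rfl⟩ := Nat.exists_eq_add_of_le hm
  obtain ⟨b, rfl⟩ := Nat.exists_eq_add_of_le hq
  have h : (2 + a) * (2 + b) = a * b + 2 * a + 2 * b + 4 := by ring
  rw [h]
  refine ⟨(a * b + a + b + 2) / 2, 1 + a + (a * b + a + b + 3) / 2, (a * b + a + b + 3) / 2, ?_⟩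
  generalize a * b = t
  omega

/-! ### The comparison for a noisy community model -/

section Comparison

variable {m q : ℕ} {lam s ξ : ℝ} {S' : Matrix (Fin (m * q)) (Fin (m * q)) ℝ}

theorem four_le_mul (hm : 2 ≤ m) (hq : 2 ≤ q) : 4 ≤ m * q := Nat.mul_le_mul hm hq

theorem noise_le_of_le_exp (hm : 2 ≤ m) (hq : 2 ≤ q) (hlam : 0 ≤ lam) (hξ0 : 0 < ξ)
    (hξ : ξ ≤ (1 + lam)⁻¹ * Real.exp (-(Real.exp 1 * ((m : ℝ) * q)))) :
    ξ ≤ Real.exp (-(Real.exp 1 * ((m * q : ℕ) : ℝ))) ∧ ξ ≤ 1 / 1000 ∧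
      lam * ((m * q : ℕ) * swapCost (m * q) ξ) ≤ 0.0001 := by
  rw [← Nat.cast_mul] at hξ
  have hn := four_le_mul hm hq
  have hn' : (4 : ℝ) ≤ (m * q : ℕ) := by exact_mod_cast hn
  have h1 := noise_le_exp hlam hξ
  have h2 := mul_exp_neg_le (u := 1) (u₀ := 1) hn' (by norm_num) (by nlinarith)
  have h3 : 0 ≤ lam * ξ := by positivity
  exact ⟨by linarith, by linarith, mul_natCast_mul_swapCost_le hn hlam hξ0 hξ⟩

/-- The communities behind `S'`, and the near-optimality of SUPER* for each noise matrix. -/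
theorem exists_communities_le_expectedGain_superStar (hm : 2 ≤ m) (hq : 2 ≤ q) (hlam : 0 ≤ lam)
    (hS' : IsNoiselessCommunity m q s S') (hξ0 : 0 < ξ)
    (hξ : ξ ≤ (1 + lam)⁻¹ * Real.exp (-(Real.exp 1 * ((m : ℝ) * q)))) :
    ∃ rc pc : Fin (m * q) → Fin m, (∀ c, (univ.filter fun i => rc i = c).card = q) ∧
      (∀ c, (univ.filter fun j => pc j = c).card = q) ∧
      (∀ i j, S' i j = if rc i = pc j then s else 0) ∧
      (∀ ν, (∀ p, ν p ∈ Set.Ioo 0 ξ) → IsCommunity q s ξ rc pc (noisySimilarity s S' ν)) ∧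
      ∀ A : Policy (m * q) (m * q),
        IsSuperStar (thresholdModel s lam) (zeroHeuristic (m * q) (m * q)) A →
        ∀ ν, (∀ p, ν p ∈ Set.Ioo 0 ξ) →
          (m * q : ℕ) + lam * ∑ i, bestValue (noisySimilarity s S' ν i) -
            lam * ((m * q : ℕ) * swapCost (m * q) ξ) ≤
              expectedGain (thresholdModel s lam) A (noisySimilarity s S' ν) := by
  obtain ⟨rc, pc, hrc, hpc, hS⟩ := hS'.exists_communities
  obtain ⟨-, h1, h2⟩ := noise_le_of_le_exp hm hq hlam hξ0 hξ
  have hC := fun ν => isCommunity_noisySimilarity (ν := ν) hS'.1 hrc hpc hS hξ0 h1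
  exact ⟨rc, pc, hrc, hpc, hS, hC, fun A hA ν hν => (hC ν hν).le_expectedGain_superStar hlam
    (by linarith [four_le_mul hm hq]) h2 hA⟩

variable {A : Policy (m * q) (m * q)}

theorem superStar_sub_simPolicy (hm : 2 ≤ m) (hq : 2 ≤ q) (hlam : 0 ≤ lam)
    (hS' : IsNoiselessCommunity m q s S') (hξ0 : 0 < ξ)
    (hξ : ξ ≤ (1 + lam)⁻¹ * Real.exp (-(Real.exp 1 * ((m : ℝ) * q))))
    (hA : IsSuperStar (thresholdModel s lam) (zeroHeuristic (m * q) (m * q)) A) :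
    (1 / 8 : ℝ) * ((m * q : ℕ) : ℝ) - 0.0001 ≤
      noisyExpectedGain (thresholdModel s lam) A s ξ S' -
        noisyExpectedGain (thresholdModel s lam) (simPolicy (m * q) (m * q)) s ξ S' := by
  classical
  obtain ⟨rc, pc, hrc, hpc, hS, hC, hge⟩ :=
    exists_communities_le_expectedGain_superStar hm hq hlam hS' hξ0 hξ
  have hcost := (noise_le_of_le_exp hm hq hlam hξ0 hξ).2.2
  have := isProbabilityMeasure_noiseLaw (m * q) (m * q) hξ0
  have hint : Integrable (fun ν => ∑ j, (dominatedSet rc pc j).indicator (fun _ => (1 : ℝ)) ν)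
      (noiseLaw (m * q) (m * q) ξ) :=
    integrable_finsetSum _ fun j _ =>
      (integrable_const (1 : ℝ)).indicator (measurableSet_dominatedSet j)
  refine le_trans ?_ (integral_le_noisyExpectedGain_sub hξ0 hlam hC
    ((hint.const_mul (1 / 2)).sub (integrable_const 0.0001)) fun ν hν => ?_)
  · have h := le_integral_sum_dominatedSet hξ0 hq hrc hpc
    simp only [Pi.sub_apply]
    rw [integral_sub (hint.const_mul _) (integrable_const _), integral_const_mul]
    simp only [integral_const, probReal_univ, one_smul]
    linarith
  · have h1 := hge A hA ν hν
    have h2 := (hC ν hν).expectedGain_simPolicy_le hlam (D := fun j => ν ∈ dominatedSet rc pc j)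
      fun j hj => isDominated_of_mem_dominatedSet hS hj
    simp only [Pi.sub_apply, Set.indicator_apply]
    linarith

theorem superStar_sub_bidPolicy (hm : 2 ≤ m) (hq : 2 ≤ q) (hlam : 0 ≤ lam)
    (hS' : IsNoiselessCommunity m q s S') (hξ0 : 0 < ξ)
    (hξ : ξ ≤ (1 + lam)⁻¹ * Real.exp (-(Real.exp 1 * ((m : ℝ) * q))))
    (hA : IsSuperStar (thresholdModel s lam) (zeroHeuristic (m * q) (m * q)) A) :
    lam * (5 / 100000 * ((m * q : ℕ) : ℝ) / Real.logb 2 ((m * q : ℕ) : ℝ) ^ 2) ≤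
      noisyExpectedGain (thresholdModel s lam) A s ξ S' -
        noisyExpectedGain (thresholdModel s lam) (bidPolicy (m * q) (m * q)) s ξ S' := by
  obtain ⟨rc, pc, -, -, -, hC, hge⟩ :=
    exists_communities_le_expectedGain_superStar hm hq hlam hS' hξ0 hξ
  obtain ⟨B, L, K, hB, hL, hLB, hK, hqB, hn, hKn⟩ := exists_displacement_parameters hm hq
  refine const_le_noisyExpectedGain_sub hξ0 hlam hC fun ν hν => ?_
  have h1 := hge A hA ν hν
  have h2 := expectedGain_le (thresholdModel_bidProb_mem s lam) fun ω hω =>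
    (hC ν hν).totalGain_bidPolicy_le (ω := ω) hlam hω hB (by omega) (by omega) hL hLB hK
  have h3 := mul_le_mul_of_nonneg_left (le_displacementLoss_sub_swapCost hS'.1.1 hξ0
    (noise_le_of_le_exp hm hq hlam hξ0 hξ).1 (four_le_mul hm hq) (by omega) hqB hn hKn) hlam
  rw [mul_sub] at h3
  linarith

theorem superStar_sub_randPolicy (hm : 2 ≤ m) (hq : 2 ≤ q) (hlam : 0 ≤ lam)
    (hS' : IsNoiselessCommunity m q s S') (hξ0 : 0 < ξ)
    (hξ : ξ ≤ (1 + lam)⁻¹ * Real.exp (-(Real.exp 1 * ((m : ℝ) * q))))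
    (hA : IsSuperStar (thresholdModel s lam) (zeroHeuristic (m * q) (m * q)) A) :
    (1 / 2 : ℝ) * ((m * q : ℕ) : ℝ) - 0.0001 ≤
      noisyExpectedGain (thresholdModel s lam) A s ξ S' -
        noisyExpectedGain (thresholdModel s lam) (randPolicy (m * q) (m * q)) s ξ S' := by
  obtain ⟨rc, pc, -, -, -, hC, hge⟩ :=
    exists_communities_le_expectedGain_superStar hm hq hlam hS' hξ0 hξ
  have hcost := (noise_le_of_le_exp hm hq hlam hξ0 hξ).2.2
  refine const_le_noisyExpectedGain_sub hξ0 hlam hC fun ν hν => ?_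
  have h1 := hge A hA ν hν
  have h2 := (hC ν hν).expectedGain_randPolicy_le hlam (Nat.mul_le_mul_right q hm)
  linarith

end Comparison

end PaperBidding

end

theorem theorem4 :
    -- (a) near-optimality of SUPER* with zero heuristic, on average over the noise and also for
    -- each fixed realization of the noise
    (∀ (m q : ℕ) (lam s ξ : ℝ) (S' : Matrix (Fin (m * q)) (Fin (m * q)) ℝ),
      2 ≤ m → 2 ≤ q → 0 ≤ lam → IsNoiselessCommunity m q s S' →
      0 < ξ → ξ ≤ (1 + lam)⁻¹ * Real.exp (-(Real.exp 1 * ((m : ℝ) * q))) →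
      ∀ A : Policy (m * q) (m * q),
        IsSuperStar (thresholdModel s lam) (zeroHeuristic (m * q) (m * q)) A →
        ∀ B : Policy (m * q) (m * q),
          (noisyExpectedGain (thresholdModel s lam) B s ξ S' - 0.0001 ≤
            noisyExpectedGain (thresholdModel s lam) A s ξ S') ∧
          ∀ ν : Fin (m * q) × Fin (m * q) → ℝ, (∀ p, ν p ∈ Set.Ioo 0 ξ) →
            expectedGain (thresholdModel s lam) B (noisySimilarity s S' ν) - 0.0001 ≤
              expectedGain (thresholdModel s lam) A (noisySimilarity s S' ν)) ∧
    -- (b), (c), (d) suboptimality of SIM, BID and RAND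
    (∃ c : ℝ, 0 < c ∧
      ∀ (m q : ℕ) (lam s ξ : ℝ) (S' : Matrix (Fin (m * q)) (Fin (m * q)) ℝ),
        2 ≤ m → 2 ≤ q → 0 ≤ lam → IsNoiselessCommunity m q s S' →
        0 < ξ → ξ ≤ (1 + lam)⁻¹ * Real.exp (-(Real.exp 1 * ((m : ℝ) * q))) →
        ∀ A : Policy (m * q) (m * q),
          IsSuperStar (thresholdModel s lam) (zeroHeuristic (m * q) (m * q)) A →
          (c * ((m : ℝ) * q) ≤
            noisyExpectedGain (thresholdModel s lam) A s ξ S' -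
              noisyExpectedGain (thresholdModel s lam) (simPolicy (m * q) (m * q)) s ξ S') ∧
          (c * lam * ((m : ℝ) * q) / Real.logb 2 ((m : ℝ) * q) ^ 2 ≤
            noisyExpectedGain (thresholdModel s lam) A s ξ S' -
              noisyExpectedGain (thresholdModel s lam) (bidPolicy (m * q) (m * q)) s ξ S') ∧
          (c * ((m : ℝ) * q) ≤
            noisyExpectedGain (thresholdModel s lam) A s ξ S' -
              noisyExpectedGain (thresholdModel s lam) (randPolicy (m * q) (m * q)) s ξ S')) := by
  refine ⟨?_, 5 / 100000, by norm_num, ?_⟩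
  · intro m q lam s ξ S' hm hq hlam hS' hξ0 hξ A hA B
    obtain ⟨rc, pc, -, -, -, hC, hge⟩ :=
      exists_communities_le_expectedGain_superStar hm hq hlam hS' hξ0 hξ
    have hcost := (noise_le_of_le_exp hm hq hlam hξ0 hξ).2.2
    have key : ∀ ν, (∀ p, ν p ∈ Set.Ioo 0 ξ) →
        -0.0001 ≤ expectedGain (thresholdModel s lam) A (noisySimilarity s S' ν) -
          expectedGain (thresholdModel s lam) B (noisySimilarity s S' ν) := by
      intro ν hν
      have h1 := hge A hA ν hν
      have h2 := (hC ν hν).expectedGain_le hlam B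
      linarith
    refine ⟨?_, fun ν hν => ?_⟩
    · have := const_le_noisyExpectedGain_sub hξ0 hlam hC key
      linarith
    · have := key ν hν
      linarith
  · intro m q lam s ξ S' hm hq hlam hS' hξ0 hξ A hA
    have hn : (4 : ℝ) ≤ (m : ℝ) * q := by exact_mod_cast four_le_mul hm hq
    have h1 := superStar_sub_simPolicy hm hq hlam hS' hξ0 hξ hA
    have h2 := superStar_sub_bidPolicy hm hq hlam hS' hξ0 hξ hA
    have h3 := superStar_sub_randPolicy hm hq hlam hS' hξ0 hξ hA
    rw [Nat.cast_mul] at h1 h2 h3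
    norm_num at h1 h3
    refine ⟨by linarith, le_trans (le_of_eq ?_) h2, by linarith⟩
    ring
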